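/- Let $\mathcal P_2(\mathbb R^d)$ be the set of probability measures on $\mathbb R^d$ with finite second moment and $\mathbb W_2$ the $L^2$-Wasserstein distance on it. Let $\rho>\kappa\ge 0$, and for every $t\ge 0$ let $R(t,\cdot)$ be a probability measure on $[0,t]$ such that $R(t,[0,s])\to 0$ as $t\to+\infty$ for every $s\ge 0$, and such that $t\mapsto\int_0^t f(s)R(t,\mathrm ds)$ is measurable for every continuous $f$. Then there is a positive function $Q$ on $\mathbb R_+$, depending only on $\rho$, $\kappa$ and $R$, with $Q(t)\to 0$ as $t\to+\infty$, such that the following holds. Let $d$ be a dimension, $M\in\mathbb R^{d\times d}$, $\sigma\ge 0$, let $a:\mathbb R^d\to\mathbb R^d$ be locally Lipschitz and $b:\mathbb R^d\times\mathcal P_2(\mathbb R^d)\to\mathbb R^d$ be globally Lipschitz, with, for all $z,y\in\mathbb R^d$ and all $\mu,\nu\in\mathcal P_2(\mathbb R^d)$, $$(z-y)\cdot\big(a(z)+b(z,\mu)-a(y)-b(y,\nu)\big)\le-\rho|z-y|^2+\kappa\,\mathbb W_2^2(\nu,\mu).$$ Let $(X_t,\mu_t,m_t)_{t\ge0}$ and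 $(\tilde X_t,\tilde\mu_t,\tilde m_t)_{t\ge0}$ be two (weak) solutions, possibly on different probability spaces, with the same $\sigma$ and with initial distributions $m_0,\tilde m_0\in\mathcal P_2(\mathbb R^d)$, of $$\mathrm dX_t=a(X_t)\,\mathrm dt+b(X_t,\mu_t)\,\mathrm dt+\sigma M\,\mathrm dB_t,\qquad \mu_t=\int_0^t m_s\,R(t,\mathrm ds),\qquad m_t=\mathcal L(X_t),$$ where $B$ is a standard $d$-dimensional Brownian motion independent of $X_0$ and $t\mapsto\int|x|^2m_t(\mathrm dx)$ is locally bounded (as is the case when $t\mapsto m_t$ is continuous into $(\mathcal P_2(\mathbb R^d),\mathbb W_2)$). Then, for all $t\ge0$, $$\mathbb W_2(m_t,\tilde m_t)+\mathbb W_2(\mu_t,\tilde\mu_t)\le Q(t)\,\mathbb W_2(m_0,\tilde m_0).$$ In particular, the rate $Q$ does not depend on $\sigma$. -/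

import Mathlib

open MeasureTheory ProbabilityTheory Filter Topology Set
open scoped NNReal ENNReal

noncomputable section

namespace MemorialMcKeanVlasov

/-- `ℝ^d` with its Euclidean norm. -/
abbrev Vec (d : ℕ) : Type := EuclideanSpace ℝ (Fin d)

/-- The second moment `∫ |x|² m(dx)`. -/
def secondMoment {d : ℕ} (m : Measure (Vec d)) : ℝ≥0∞ := ∫⁻ x, ‖x‖ₑ ^ 2 ∂m

/-- `𝒫₂(ℝ^d)`: Borel probability measures on `ℝ^d` with a finite second moment. -/
def P2 (d : ℕ) : Type :=
  {m : Measure (Vec d) // IsProbabilityMeasure m ∧ secondMoment m < ∞}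

/-- The measure underlying an element of `𝒫₂(ℝ^d)`. -/
def P2.toMeasure {d : ℕ} (m : P2 d) : Measure (Vec d) := m.1

/-- `π` is a coupling of `m` and `n`: its two marginals are `m` and `n`. -/
def IsCoupling {d : ℕ} (π : Measure (Vec d × Vec d)) (m n : Measure (Vec d)) : Prop :=
  π.map Prod.fst = m ∧ π.map Prod.snd = n

/-- The optimal quadratic transport cost, the infimum of `∫ |x - y|² π(dx dy)` over all couplings
`π` of `m` and `n`, as an extended nonnegative number. -/
def transportCost {d : ℕ} (m n : P2 d) : ℝ≥0∞ :=
  ⨅ (π : Measure (Vec d × Vec d)) (_ : IsCoupling π m.toMeasure n.toMeasure),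
    ∫⁻ p, ‖p.1 - p.2‖ₑ ^ 2 ∂π

/-- The `L²`-Wasserstein distance on `𝒫₂(ℝ^d)`. It is the square root of the optimal transport cost,
which is finite on `𝒫₂(ℝ^d)` by `transportCost_lt_top`. -/
def W2 {d : ℕ} (m n : P2 d) : ℝ := √(transportCost m n).toReal

lemma transportCost_lt_top {d : ℕ} (m n : P2 d) : transportCost m n < ∞ := by
  obtain ⟨m, hm, hm2⟩ := m
  obtain ⟨n, hn, hn2⟩ := n
  have h : IsCoupling (m.prod n) m n := by
    constructor
    · rw [Measure.map_fst_prod]; simp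
    · rw [Measure.map_snd_prod]; simp
  refine lt_of_le_of_lt (iInf₂_le (m.prod n) h) ?_
  have hpt : ∀ p : Vec d × Vec d,
      ‖p.1 - p.2‖ₑ ^ 2 ≤ 2 * ‖p.1‖ₑ ^ 2 + 2 * ‖p.2‖ₑ ^ 2 := by
    intro p
    have h1 : ‖p.1 - p.2‖₊ ^ 2 ≤ 2 * ‖p.1‖₊ ^ 2 + 2 * ‖p.2‖₊ ^ 2 := by
      rw [← NNReal.coe_le_coe]
      push_cast
      nlinarith [norm_sub_le p.1 p.2, norm_nonneg (p.1 - p.2), sq_nonneg (‖p.1‖ - ‖p.2‖)]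
    simp only [enorm_eq_nnnorm]
    exact_mod_cast h1
  refine lt_of_le_of_lt (lintegral_mono hpt) ?_
  have hmeas : Measurable fun x : Vec d => ‖x‖ₑ ^ 2 := by fun_prop
  rw [lintegral_add_left (by fun_prop), lintegral_const_mul _ (by fun_prop),
    lintegral_const_mul _ (by fun_prop)]
  have e1 : ∫⁻ p : Vec d × Vec d, ‖p.1‖ₑ ^ 2 ∂(m.prod n) = secondMoment m := by
    rw [← lintegral_map hmeas measurable_fst, h.1, secondMoment]
  have e2 : ∫⁻ p : Vec d × Vec d, ‖p.2‖ₑ ^ 2 ∂(m.prod n) = secondMoment n := by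
    rw [← lintegral_map hmeas measurable_snd, h.2, secondMoment]
  rw [e1, e2]
  exact ENNReal.add_lt_top.2 ⟨ENNReal.mul_lt_top (by simp) hm2, ENNReal.mul_lt_top (by simp) hn2⟩

/-- The hypotheses on the memory kernel `R`: every `R(t, ·)` is a probability measure on `[0, t]`,
`R(t, [0, s]) → 0` as `t → ∞` for every `s`, and `t ↦ ∫₀ᵗ f(s) R(t, ds)` is measurable for every
continuous `f`. -/
structure IsMemoryKernel (R : ℝ≥0 → Measure ℝ≥0) : Prop where
  prob : ∀ t, IsProbabilityMeasure (R t)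
  support : ∀ t, R t (Iic t) = 1
  forget : ∀ s, Tendsto (fun t => R t (Iic s)) atTop (𝓝 0)
  measurable : ∀ f : ℝ≥0 → ℝ, Continuous f → Measurable fun t => ∫ s in Iic t, f s ∂(R t)

/-- The hypotheses on the drift functions `a` and `b`: `a` is locally Lipschitz, `b` is globally
Lipschitz on `ℝ^d × 𝒫₂(ℝ^d)`, and the contraction condition holds with the constants `ρ`, `κ`. -/
structure DriftCondition {d : ℕ} (a : Vec d → Vec d) (b : Vec d → P2 d → Vec d)
    (ρ κ : ℝ) : Prop where
  locLip : LocallyLipschitz a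
  lip : ∃ L : ℝ≥0, ∀ z y m n, ‖b z m - b y n‖ ≤ L * (‖z - y‖ + W2 m n)
  contract : ∀ z y m n,
    inner ℝ (z - y) (a z + b z m - a y - b y n) ≤ -ρ * ‖z - y‖ ^ 2 + κ * W2 n m ^ 2

/-- `B` is a standard Brownian motion on `ℝ^d`: its coordinates are independent standard real
Brownian motions. -/
structure IsBrownianVec {d : ℕ} {Ω : Type*} [MeasurableSpace Ω] (B : ℝ≥0 → Ω → Vec d)
    (P : Measure Ω) : Prop where
  measurable : ∀ t, Measurable (B t)
  coord : ∀ i, IsBrownianReal (fun t ω => B t ω i) P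
  indep : iIndepFun (fun (i : Fin d) (ω : Ω) (t : ℝ≥0) => B t ω i) P

/-- `(X, μ, m)` is a (weak) solution, driven by the Brownian motion `B` on `(Ω, P)`, of
`dX_t = a(X_t) dt + b(X_t, μ_t) dt + σ M dB_t`, `μ_t = ∫₀ᵗ m_s R(t, ds)`, `m_t = Law(X_t)`.

The noise is additive, so the equation makes sense path by path. As for any weak solution, the
initial position is independent of the driving Brownian motion. The second moments of `m_t` are
locally bounded in time (which is the case when `t ↦ m_t` is continuous into `𝒫₂(ℝ^d)`), so that the
mixture `μ_t` stays in `𝒫₂(ℝ^d)`, where `b` is defined. -/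
structure IsSolution {d : ℕ} (a : Vec d → Vec d) (b : Vec d → P2 d → Vec d)
    (M : Matrix (Fin d) (Fin d) ℝ) (R : ℝ≥0 → Measure ℝ≥0) (σ : ℝ)
    {Ω : Type*} [MeasurableSpace Ω] (P : Measure Ω) (B : ℝ≥0 → Ω → Vec d)
    (X : ℝ≥0 → Ω → Vec d) (μ m : ℝ≥0 → P2 d) : Prop where
  brownian : IsBrownianVec B P
  measurable : ∀ t, Measurable (X t)
  continuous : ∀ᵐ ω ∂P, Continuous fun t => X t ω
  indep : IndepFun (X 0) (fun ω t => B t ω) P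
  law : ∀ t, P.map (X t) = (m t).toMeasure
  moment : ∀ T, ∃ C : ℝ≥0, ∀ s ≤ T, secondMoment (m s).toMeasure ≤ C
  memory : ∀ t A, MeasurableSet A →
    (μ t).toMeasure A = ∫⁻ s in Iic t, (m s).toMeasure A ∂(R t)
  integrable : ∀ᵐ ω ∂P, ∀ t : ℝ≥0, IntervalIntegrable
    (fun s : ℝ => a (X s.toNNReal ω) + b (X s.toNNReal ω) (μ s.toNNReal)) volume 0 t
  equation : ∀ᵐ ω ∂P, ∀ t : ℝ≥0, X t ω = X 0 ω
    + (∫ s in (0 : ℝ)..t, (a (X s.toNNReal ω) + b (X s.toNNReal ω) (μ s.toNNReal)))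
    + σ • Matrix.toEuclideanCLM (𝕜 := ℝ) M (B t ω)

end MemorialMcKeanVlasov

end

open MemorialMcKeanVlasov

open MeasureTheory ProbabilityTheory Filter Topology Set
open scoped NNReal ENNReal

noncomputable section

namespace MemorialMcKeanVlasov

/-! The proof is a synchronous coupling. Both solutions are realized on one probability space with
the same Brownian motion and with initial positions coupled by a nearly optimal plan. The noise is
additive, so it cancels in the difference `z` of the two paths, and neither `σ` nor `M` enters the
estimate. The contraction condition gives `⟨z, z'⟩ ≤ -ρ |z|² + κ W2²`, where the distance is that of
the two averages. If this squared distance is at most `D` on `[s, t]`, then `exp (2 ρ r) (|z_r|² - κ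
D / ρ)` does not increase from `s` to `t` (`exp_mul_norm_sq_sub_le`,
`DriftCondition.path_contraction`).

Put `g t = E |z_t|²`. The average of the couplings along `R(t, ·)` couples the two averages, so
their squared distance is at most `∫ g dR(t, ·)`. Hence `g` obeys a closed scalar inequality
(`IsContractiveProfile`) that knows only `R`, `ρ`, `κ`. Since `κ / ρ < 1`, `g` never exceeds its
initial bound `c`. Since the kernel forgets every bounded time interval, waiting long enough
multiplies the bound by a factor `η < 1`, again and again (`exists_forall_profile_le`). A supremum
over all profiles is then a rate independent of the equation (`exists_profile_rate`).

For weak solutions the coupling itself needs work (`exists_synchronous_coupling`). Paths are encoded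
by their values at countably many times, which gives a standard Borel space. The conditional laws of
the solutions given initial position and noise are glued over a common base. The equation passes to
the glued space because it is a measurable condition on sampled paths, which requires a jointly
measurable drift. -/

/-! ### Integrated dissipative inequality. -/

lemma absolutelyContinuousOnInterval_finset_sum {ι : Type*} (I : Finset ι) {f : ι → ℝ → ℝ}
    {s t : ℝ} (hf : ∀ i, AbsolutelyContinuousOnInterval (f i) s t) :
    AbsolutelyContinuousOnInterval (fun r => ∑ i ∈ I, f i r) s t := by
  classical
  induction I using Finset.induction_on with
  | empty =>
    have h : LipschitzOnWith 0 (fun _ : ℝ => (0 : ℝ)) (uIcc s t) :=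
      (LipschitzWith.const 0).lipschitzOnWith
    simpa using h.absolutelyContinuousOnInterval
  | insert i I hi ih =>
    simp only [Finset.sum_insert hi]
    exact (hf i).fun_add ih

/-- A dissipative differential inequality, integrated: if `z' = u` with
`⟨z, u⟩ ≤ ρ (K - |z|²)`, then `e^{2 ρ r} (|z_r|² - K)` is nonincreasing. -/
theorem exp_mul_norm_sq_sub_le {d : ℕ} {ρ K s t : ℝ} (hst : s ≤ t) {z u : ℝ → Vec d}
    (hu : IntervalIntegrable u volume s t)
    (hz : ∀ r ∈ Icc s t, z r = z s + ∫ x in s..r, u x)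
    (h : ∀ᵐ r, r ∈ Icc s t → inner ℝ (z r) (u r) ≤ ρ * (K - ‖z r‖ ^ 2)) :
    Real.exp (2 * ρ * t) * (‖z t‖ ^ 2 - K) ≤ Real.exp (2 * ρ * s) * (‖z s‖ ^ 2 - K) := by
  have hui : ∀ i, IntervalIntegrable (fun x => u x i) volume s t := fun i =>
    ⟨(EuclideanSpace.proj (𝕜 := ℝ) i).integrable_comp hu.1,
      (EuclideanSpace.proj (𝕜 := ℝ) i).integrable_comp hu.2⟩
  -- `z` is controlled only on `[s, t]`; the primitive `w` agrees with it there and has derivative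
  -- `u r` at almost every `r` of the interval.
  set w : ℝ → Vec d := fun r => z s + ∫ x in s..r, u x with hw
  have hwi : ∀ i, ∀ r ∈ Icc s t, w r i = z s i + ∫ x in s..r, u x i := by
    intro i r hr
    have : ∫ x in s..r, u x i = (∫ x in s..r, u x) i :=
      (EuclideanSpace.proj (𝕜 := ℝ) i).intervalIntegral_comp_comm
        (hu.mono_set (by rw [uIcc_of_le hr.1, uIcc_of_le hst]; exact Icc_subset_Icc_right hr.2))
    simp [hw, this]
  have hlip : ∀ f : ℝ → ℝ, ContDiff ℝ 1 f → AbsolutelyContinuousOnInterval f s t := by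
    intro f hf
    exact hf.contDiffOn.absolutelyContinuousOnInterval
  have hA : ∀ i, AbsolutelyContinuousOnInterval
      (fun r => z s i + ∫ x in s..r, u x i) s t := fun i =>
    (hlip _ contDiff_const).fun_add
      ((hui i).absolutelyContinuousOnInterval_intervalIntegral left_mem_uIcc)
  -- As `u` is only integrable, `φ` is differentiable only almost everywhere. Absolute continuity,
  -- checked coordinate by coordinate, still lets the sign of `deriv φ` decide.
  set φ : ℝ → ℝ := fun r => Real.exp (2 * ρ * r) *
    (∑ i, (z s i + ∫ x in s..r, u x i) * (z s i + ∫ x in s..r, u x i) - K) with hφ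
  have hφAC : AbsolutelyContinuousOnInterval φ s t :=
    (hlip _ (by fun_prop)).fun_mul
      ((absolutelyContinuousOnInterval_finset_sum _ fun i => (hA i).fun_mul (hA i)).fun_sub
        (hlip _ contDiff_const))
  have hφw : ∀ r ∈ Icc s t, φ r = Real.exp (2 * ρ * r) * (‖w r‖ ^ 2 - K) := by
    intro r hr
    simp only [hφ, EuclideanSpace.norm_sq_eq, Real.norm_eq_abs, sq_abs]
    congr 2
    exact Finset.sum_congr rfl fun i _ => by rw [hwi i r hr, sq]
  have hderiv : ∀ᵐ r, r ∈ Icc s t → deriv φ r ≤ 0 := by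
    have hne : ∀ᵐ r : ℝ, r ≠ s ∧ r ≠ t := by
      filter_upwards [compl_mem_ae_iff.2 (measure_singleton s),
        compl_mem_ae_iff.2 (measure_singleton t)] with r h1 h2 using ⟨h1, h2⟩
    filter_upwards [h, hu.ae_hasDerivAt_integral, hne] with r h1 h2 h3 hr
    have hrs : Icc s t ∈ 𝓝 r := Icc_mem_nhds (lt_of_le_of_ne hr.1 (Ne.symm h3.1))
      (lt_of_le_of_ne hr.2 h3.2)
    have hd : HasDerivAt w (u r) r :=
      (h2 (by rwa [uIcc_of_le hst]) s left_mem_uIcc).const_add _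
    have hd2 := ((((hasDerivAt_id r).const_mul (2 * ρ)).exp).mul
      ((hd.norm_sq).sub_const K))
    have heq : φ =ᶠ[𝓝 r] fun r => Real.exp (2 * ρ * r) * (‖w r‖ ^ 2 - K) := by
      filter_upwards [hrs] with r hr using hφw r hr
    have hd3 := (hd2.congr_of_eventuallyEq heq).deriv
    rw [hd3]
    have hwz : w r = z r := (hz r hr).symm
    have h1' := h1 hr
    simp only [hwz, id, mul_one]
    have := mul_le_mul_of_nonneg_left h1' (Real.exp_pos (2 * ρ * r)).le
    nlinarith
  have hint := hφAC.integral_deriv_eq_sub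
  have hle : ∫ x in s..t, deriv φ x ≤ 0 := by
    rw [intervalIntegral.integral_of_le hst]
    refine integral_nonpos_of_ae ?_
    rw [EventuallyLE, ae_restrict_iff' measurableSet_Ioc]
    filter_upwards [hderiv] with r hr hr2 using hr (Ioc_subset_Icc_self hr2)
  have e1 := hφw t (right_mem_Icc.2 hst)
  have e2 := hφw s (left_mem_Icc.2 hst)
  rw [show w t = z t from (hz t (right_mem_Icc.2 hst)).symm] at e1
  rw [show w s = z s from (hz s (left_mem_Icc.2 hst)).symm] at e2
  linarith

/-! ### Scalar profiles with memory and their uniform decay. -/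

/-- A nonnegative profile `g` on `ℝ₊` starting below `c` and contracted at rate `2 ρ` up to a
memory term which is at most `κ / ρ` times the averages of `g` along the kernel `R`. -/
structure IsContractiveProfile (R : ℝ≥0 → Measure ℝ≥0) (ρ κ c : ℝ) (g : ℝ≥0 → ℝ) : Prop where
  nonneg : ∀ t, 0 ≤ g t
  init : g 0 ≤ c
  bdd : ∀ T, ∃ C, ∀ t ≤ T, g t ≤ C
  step : ∀ (s t : ℝ≥0) (D : ℝ), s ≤ t → 0 ≤ D →
    (∀ r ∈ Icc s t, ∫⁻ u, ENNReal.ofReal (g u) ∂(R r) ≤ ENNReal.ofReal D) →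
    Real.exp (2 * ρ * t) * (g t - κ / ρ * D) ≤ Real.exp (2 * ρ * s) * (g s - κ / ρ * D)

section Profile

variable {R : ℝ≥0 → Measure ℝ≥0} {ρ κ c : ℝ} {g : ℝ≥0 → ℝ}

lemma IsMemoryKernel.ae_le (hR : IsMemoryKernel R) (t : ℝ≥0) : ∀ᵐ u ∂(R t), u ≤ t := by
  have := hR.prob t
  exact (prob_compl_eq_zero_iff measurableSet_Iic).2 (hR.support t)

lemma IsMemoryKernel.lintegral_le (hR : IsMemoryKernel R) {t : ℝ≥0} {C : ℝ}
    (hg : ∀ u ≤ t, g u ≤ C) : ∫⁻ u, ENNReal.ofReal (g u) ∂(R t) ≤ ENNReal.ofReal C := by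
  have := hR.prob t
  calc ∫⁻ u, ENNReal.ofReal (g u) ∂(R t) ≤ ∫⁻ _, ENNReal.ofReal C ∂(R t) := by
        refine lintegral_mono_ae ?_
        filter_upwards [hR.ae_le t] with u hu using ENNReal.ofReal_le_ofReal (hg u hu)
    _ = ENNReal.ofReal C := by simp

/-- Times after `T` contribute at most `c * D`, and times up to `T` contribute at most `c` times
their mass `δ`. -/
lemma IsMemoryKernel.lintegral_le_add (hR : IsMemoryKernel R) {t T : ℝ≥0} {D δ : ℝ}
    (hc : 0 ≤ c) (hD : 0 ≤ D) (hδ : 0 ≤ δ) (hg : ∀ u, g u ≤ c) (hgT : ∀ u, T ≤ u → g u ≤ c * D)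
    (hRT : R t (Iic T) ≤ ENNReal.ofReal δ) :
    ∫⁻ u, ENNReal.ofReal (g u) ∂(R t) ≤ ENNReal.ofReal (c * (D + δ)) := by
  have := hR.prob t
  calc ∫⁻ u, ENNReal.ofReal (g u) ∂(R t)
      ≤ ∫⁻ u, ENNReal.ofReal (c * D) + (Iic T).indicator (fun _ => ENNReal.ofReal c) u ∂(R t) := by
        refine lintegral_mono fun u => ?_
        by_cases hu : u ≤ T
        · rw [indicator_of_mem (show u ∈ Iic T from hu)]
          exact (ENNReal.ofReal_le_ofReal (hg u)).trans le_add_self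
        · rw [indicator_of_notMem (show u ∉ Iic T from hu), add_zero]
          exact ENNReal.ofReal_le_ofReal (hgT u (not_le.1 hu).le)
    _ = ENNReal.ofReal (c * D) + ENNReal.ofReal c * R t (Iic T) := by
        rw [lintegral_add_left measurable_const, lintegral_indicator_const measurableSet_Iic]
        simp
    _ ≤ ENNReal.ofReal (c * D) + ENNReal.ofReal c * ENNReal.ofReal δ := by gcongr
    _ = ENNReal.ofReal (c * (D + δ)) := by
        rw [← ENNReal.ofReal_mul hc, ← ENNReal.ofReal_add (by positivity) (by positivity), mul_add]

/-- Bootstrap: if `g ≤ G` on `[0, t]`, the averages are at most `G` too, and contraction from time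
`0` improves the bound to `max c (θ G)`. Iterating from any bound `C` leaves only `c`, because `θ ^
n * C` eventually falls below `c > 0`. -/
theorem IsContractiveProfile.le (hR : IsMemoryKernel R) (hκ : 0 ≤ κ) (hκρ : κ < ρ) (hc : 0 < c)
    (hg : IsContractiveProfile R ρ κ c g) (t : ℝ≥0) : g t ≤ c := by
  have hρ : 0 < ρ := hκ.trans_lt hκρ
  set θ := κ / ρ with hθ
  have hθ0 : 0 ≤ θ := by positivity
  have hθ1 : θ < 1 := (div_lt_one hρ).2 hκρ
  obtain ⟨C, hC⟩ := hg.bdd t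
  have key : ∀ n : ℕ, ∀ s ≤ t, g s ≤ max c (θ ^ n * C) := by
    intro n
    induction n with
    | zero => intro s hs; simpa using Or.inr (hC s hs)
    | succ n ih =>
      intro s hs
      set G := max c (θ ^ n * C) with hG
      have hcG : c ≤ G := le_max_left _ _
      have h1 := hg.step 0 s G zero_le (hc.le.trans hcG) fun r hr =>
        hR.lintegral_le fun u hu => ih u (hu.trans (hr.2.trans hs))
      rw [← hθ] at h1
      have h0 := hg.init
      have he : 1 ≤ Real.exp (2 * ρ * s) := Real.one_le_exp (by positivity)
      simp only [NNReal.coe_zero, mul_zero, Real.exp_zero, one_mul] at h1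
      -- The sign of `c - θ G` decides: either `g s - θ G` is at most `0`, or it is at most `c - θ
      -- G`.
      by_cases hcase : c ≤ θ * G
      · have : g s ≤ θ * G := by
          by_contra! hlt
          nlinarith
        refine this.trans ?_
        rw [hG, mul_max_of_nonneg _ _ hθ0]
        refine max_le_max (by nlinarith) (by rw [pow_succ']; exact (mul_assoc _ _ _).ge)
      · push Not at hcase
        refine le_max_of_le_left ?_
        by_contra! hlt
        nlinarith
  have hlim : Tendsto (fun n : ℕ => θ ^ n * C) atTop (𝓝 (0 * C)) :=
    (tendsto_pow_atTop_nhds_zero_of_lt_one hθ0 hθ1).mul_const C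
  rw [zero_mul] at hlim
  obtain ⟨n, hn⟩ := (hlim.eventually (gt_mem_nhds hc)).exists
  simpa [max_eq_left hn.le] using key n t le_rfl

/-- Contractive profiles decay at a rate which only depends on `R`, `ρ` and `κ`. -/
theorem exists_forall_profile_le (hR : IsMemoryKernel R) (hκ : 0 ≤ κ) (hκρ : κ < ρ) {ε : ℝ}
    (hε : 0 < ε) : ∃ T : ℝ≥0, ∀ (c : ℝ) (g : ℝ≥0 → ℝ), 0 < c → IsContractiveProfile R ρ κ c g →
      ∀ t, T ≤ t → g t ≤ c * ε := by
  have hρ : 0 < ρ := hκ.trans_lt hκρ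
  have hθ0 : 0 ≤ κ / ρ := by positivity
  have hθ1 : κ / ρ < 1 := (div_lt_one hρ).2 hκρ
  obtain ⟨η, hη, hη1⟩ := exists_between hθ1
  have hη0 : 0 < η := hθ0.trans_lt hη
  have key : ∀ n : ℕ, ∃ T : ℝ≥0, ∀ (c : ℝ) (g : ℝ≥0 → ℝ), 0 < c →
      IsContractiveProfile R ρ κ c g → ∀ t, T ≤ t → g t ≤ c * η ^ n := by
    intro n
    induction n with
    | zero =>
      refine ⟨0, fun c g hc hg t _ => ?_⟩
      simpa using hg.le hR hκ hκρ hc t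
    | succ n ih =>
      obtain ⟨T, hT⟩ := ih
      -- Restarting at `S` leaves three terms, each times `c`: `κ / ρ * η ^ n`, the old mass `κ / ρ
      -- * δ ≤ δ`, and the decayed initial value, at most `δ`. This `δ` makes `κ / ρ * η ^ n + 2 δ`
      -- equal to `η ^ (n + 1)`.
      set δ := (η - κ / ρ) * η ^ n / 2 with hδ
      have hδ0 : 0 < δ := div_pos (mul_pos (sub_pos.2 hη) (pow_pos hη0 n)) two_pos
      obtain ⟨S, hS⟩ := eventually_atTop.1 ((hR.forget T).eventually
        (Iic_mem_nhds (ENNReal.ofReal_pos.2 hδ0)))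
      have hexp : Tendsto (fun t : ℝ≥0 => Real.exp (-(2 * ρ * t)) * Real.exp (2 * ρ * S)) atTop
          (𝓝 (0 * Real.exp (2 * ρ * S))) :=
        (Real.tendsto_exp_neg_atTop_nhds_zero.comp
          (NNReal.tendsto_coe_atTop.2 tendsto_id |>.const_mul_atTop (by positivity))).mul_const _
      rw [zero_mul] at hexp
      obtain ⟨S', hS'⟩ := eventually_atTop.1 (hexp.eventually (Iic_mem_nhds hδ0))
      refine ⟨max S S', fun c g hc hg t ht => ?_⟩
      have hle := hg.le hR hκ hκρ hc
      have h1 := hg.step S t (c * (η ^ n + δ)) ((le_max_left _ _).trans ht) (by positivity)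
        fun r hr => hR.lintegral_le_add hc.le (by positivity) hδ0.le hle (hT c g hc hg) (hS r hr.1)
      have h2 : Real.exp (-(2 * ρ * t)) * Real.exp (2 * ρ * S) ≤ δ :=
        hS' t ((le_max_right _ _).trans ht)
      have h3 : 0 ≤ κ / ρ * (c * (η ^ n + δ)) := by positivity
      have h4 : Real.exp (2 * ρ * S) * (g S - κ / ρ * (c * (η ^ n + δ)))
          ≤ Real.exp (2 * ρ * S) * c := by
        have := hle S
        gcongr
        linarith
      have h5 := mul_le_mul_of_nonneg_left (h1.trans h4) (Real.exp_pos (-(2 * ρ * t))).le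
      rw [← mul_assoc, ← Real.exp_add, neg_add_cancel, Real.exp_zero, one_mul, ← mul_assoc] at h5
      have h6 := mul_le_mul_of_nonneg_right h2 hc.le
      have h7 : κ / ρ * δ ≤ δ := by nlinarith
      have h8 : κ / ρ * η ^ n + 2 * δ = η ^ (n + 1) := by rw [hδ]; ring
      have h9 := mul_le_mul_of_nonneg_left h7 hc.le
      rw [← h8]
      nlinarith
  obtain ⟨n, hn⟩ := exists_pow_lt_of_lt_one hε hη1
  obtain ⟨T, hT⟩ := key n
  exact ⟨T, fun c g hc hg t ht => (hT c g hc hg t ht).trans (by gcongr)⟩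

/-- One positive rate tending to `0` controls all contractive profiles and their averages. -/
theorem exists_profile_rate (hR : IsMemoryKernel R) (hκ : 0 ≤ κ) (hκρ : κ < ρ) :
    ∃ Q : ℝ≥0 → ℝ, (∀ t, 0 < Q t) ∧ Tendsto Q atTop (𝓝 0) ∧
      ∀ (c : ℝ) (g : ℝ≥0 → ℝ), 0 < c → IsContractiveProfile R ρ κ c g → ∀ t,
        √(g t) + √(∫⁻ u, ENNReal.ofReal (g u) ∂(R t)).toReal ≤ Q t * √c := by
  let v : (ℝ≥0 → ℝ) → ℝ≥0 → ℝ := fun g t =>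
    √(g t) + √(∫⁻ u, ENNReal.ofReal (g u) ∂(R t)).toReal
  -- Profiles are plain functions of time, so this supremum involves no dimension or probability
  -- space. The inserted `0` makes the set nonempty and its supremum nonnegative.
  let S : ℝ≥0 → Set ℝ := fun t =>
    insert 0 {x | ∃ c g, 0 < c ∧ IsContractiveProfile R ρ κ c g ∧ x = v g t / √c}
  have hbound : ∀ (D : ℝ) (c : ℝ) (g : ℝ≥0 → ℝ) (t : ℝ≥0), 0 < c → 0 ≤ D → g t ≤ c * D →
      ∫⁻ u, ENNReal.ofReal (g u) ∂(R t) ≤ ENNReal.ofReal (c * D) → v g t / √c ≤ 2 * √D := by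
    intro D c g t hc hD h1 h2
    have hcs : 0 < √c := Real.sqrt_pos.2 hc
    rw [div_le_iff₀ hcs]
    have h3 : √(g t) ≤ √c * √D := by
      rw [← Real.sqrt_mul hc.le]; exact Real.sqrt_le_sqrt h1
    have h4 : √(∫⁻ u, ENNReal.ofReal (g u) ∂(R t)).toReal ≤ √c * √D := by
      rw [← Real.sqrt_mul hc.le]
      refine Real.sqrt_le_sqrt (ENNReal.toReal_le_of_le_ofReal (by positivity) h2)
    simp only [v]
    linarith
  have hbdd : ∀ t, BddAbove (S t) := by
    refine fun t => ⟨2, ?_⟩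
    rintro x (rfl | ⟨c, g, hc, hg, rfl⟩)
    · norm_num
    · have hle := hg.le hR hκ hκρ hc
      simpa using hbound 1 c g t hc zero_le_one (by simpa using hle t)
        (hR.lintegral_le fun u _ => by simpa using hle u)
  have hnn : ∀ t, 0 ≤ sSup (S t) := fun t => le_csSup (hbdd t) (mem_insert _ _)
  -- The exponential only serves to make the rate strictly positive.
  refine ⟨fun t => sSup (S t) + Real.exp (-t), fun t => add_pos_of_nonneg_of_pos (hnn t)
    (Real.exp_pos _), ?_, fun c g hc hg t => ?_⟩
  · have hexp : Tendsto (fun t : ℝ≥0 => Real.exp (-(t : ℝ))) atTop (𝓝 0) :=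
      Real.tendsto_exp_neg_atTop_nhds_zero.comp (NNReal.tendsto_coe_atTop.2 tendsto_id)
    suffices h : Tendsto (fun t => sSup (S t)) atTop (𝓝 0) by simpa using h.add hexp
    rw [Metric.tendsto_atTop]
    intro ε hε
    -- One `η` bounds the profile at late times and another the mass of early times; `2 √(η + η)` is
    -- then `ε / 2`.
    set η := (ε / 4) ^ 2 / 2 with hη
    have hη0 : 0 < η := by positivity
    obtain ⟨T, hT⟩ := exists_forall_profile_le hR hκ hκρ hη0
    obtain ⟨T', hT'⟩ := eventually_atTop.1 ((hR.forget T).eventually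
        (Iic_mem_nhds (ENNReal.ofReal_pos.2 hη0)))
    refine ⟨max T T', fun t ht => ?_⟩
    rw [Real.dist_eq, sub_zero, abs_of_nonneg (hnn t)]
    have hsq : √(η + η) = ε / 4 := by
      rw [show η + η = (ε / 4) ^ 2 by rw [hη]; ring, Real.sqrt_sq (by positivity)]
    refine lt_of_le_of_lt (csSup_le (insert_nonempty _ _) (a := ε / 2) ?_) (by linarith)
    rintro x (rfl | ⟨c, g, hc, hg, rfl⟩)
    · positivity
    · have hle := hg.le hR hκ hκρ hc
      refine (hbound (η + η) c g t hc (by positivity) ?_ ?_).trans (by rw [hsq]; linarith)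
      · exact (hT c g hc hg t ((le_max_left _ _).trans ht)).trans (by gcongr; linarith)
      · exact hR.lintegral_le_add hc.le hη0.le hη0.le hle (hT c g hc hg)
          (hT' t ((le_max_right _ _).trans ht))
  · have h1 : v g t / √c ≤ sSup (S t) := le_csSup (hbdd t) (Or.inr ⟨c, g, hc, hg, rfl⟩)
    rw [div_le_iff₀ (Real.sqrt_pos.2 hc)] at h1
    refine h1.trans ?_
    gcongr
    linarith [Real.exp_pos (-(t : ℝ))]

end Profile

/-! ### Transport estimates and measurability of Lipschitz functions on `P2`. -/

section Wasserstein

variable {d : ℕ}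

lemma P2.isProbabilityMeasure (m : P2 d) : IsProbabilityMeasure m.toMeasure := m.2.1

lemma transportCost_le {m n : P2 d} {π : Measure (Vec d × Vec d)}
    (hπ : IsCoupling π m.toMeasure n.toMeasure) :
    transportCost m n ≤ ∫⁻ p, ‖p.1 - p.2‖ₑ ^ 2 ∂π := iInf₂_le π hπ

lemma W2_nonneg (m n : P2 d) : 0 ≤ W2 m n := Real.sqrt_nonneg _

lemma W2_le_sqrt {m n : P2 d} {C : ℝ≥0∞} (hC : C ≠ ∞) (h : transportCost m n ≤ C) :
    W2 m n ≤ √C.toReal :=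
  Real.sqrt_le_sqrt (ENNReal.toReal_mono hC h)

/-- Two measures with a common part and remainders of mass `ε`, carried by the ball of radius `K`,
are at transport cost at most `(2 K)² ε`. -/
lemma transportCost_le_of_common_part {m n : P2 d} {c α β : Measure (Vec d)} {ε : ℝ≥0∞} {K : ℝ≥0}
    [IsFiniteMeasure α] [IsFiniteMeasure β]
    (hm : m.toMeasure = c + α) (hn : n.toMeasure = c + β) (hα : α univ = ε) (hβ : β univ = ε)
    (hαK : ∀ᵐ x ∂α, ‖x‖ₑ ≤ K) (hβK : ∀ᵐ x ∂β, ‖x‖ₑ ≤ K) :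
    transportCost m n ≤ (K + K) ^ 2 * ε := by
  have hε : ε ≠ ∞ := hα ▸ measure_ne_top α univ
  have hdiag : Measurable fun x : Vec d => (x, x) := by fun_prop
  -- When `ε = 0` the factor `ε⁻¹ * ε` is `0` instead of `1`, which is harmless since `α` vanishes.
  have hαm : (ε⁻¹ * ε) • α = α := by
    rcases eq_or_ne ε 0 with rfl | h0
    · rw [Measure.measure_univ_eq_zero.1 hα, smul_zero]
    · rw [ENNReal.inv_mul_cancel h0 hε, one_smul]
  have hβm : (ε⁻¹ * ε) • β = β := by
    rcases eq_or_ne ε 0 with rfl | h0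
    · rw [Measure.measure_univ_eq_zero.1 hβ, smul_zero]
    · rw [ENNReal.inv_mul_cancel h0 hε, one_smul]
  -- The common part stays in place on the diagonal; the remainders are coupled by their normalized
  -- product.
  have hπ : IsCoupling (c.map (fun x => (x, x)) + ε⁻¹ • α.prod β) m.toMeasure n.toMeasure := by
    constructor
    · rw [Measure.map_add _ _ measurable_fst, Measure.map_map measurable_fst hdiag,
        Measure.map_smul, Measure.map_fst_prod, hβ, smul_smul, hαm, hm]
      congr 1
      exact Measure.map_id
    · rw [Measure.map_add _ _ measurable_snd, Measure.map_map measurable_snd hdiag,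
        Measure.map_smul, Measure.map_snd_prod, hα, smul_smul, hβm, hn]
      congr 1
      exact Measure.map_id
  refine (transportCost_le hπ).trans ?_
  have hmeas : Measurable fun p : Vec d × Vec d => ‖p.1 - p.2‖ₑ ^ 2 := by fun_prop
  rw [lintegral_add_measure, lintegral_map hmeas hdiag, lintegral_smul_measure]
  simp only [sub_self, enorm_zero, ne_eq, OfNat.ofNat_ne_zero, not_false_eq_true, zero_pow,
    lintegral_zero, zero_add]
  have hle : ∫⁻ p, ‖p.1 - p.2‖ₑ ^ 2 ∂(α.prod β) ≤ ((K : ℝ≥0∞) + K) ^ 2 * (ε * ε) := by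
    calc ∫⁻ p, ‖p.1 - p.2‖ₑ ^ 2 ∂(α.prod β)
        ≤ ∫⁻ _, ((K : ℝ≥0∞) + K) ^ 2 ∂(α.prod β) := by
          refine lintegral_mono_ae ?_
          have h1 : ∀ᵐ p ∂(α.prod β), ‖p.1‖ₑ ≤ K := Measure.quasiMeasurePreserving_fst.ae hαK
          have h2 : ∀ᵐ p ∂(α.prod β), ‖p.2‖ₑ ≤ K := Measure.quasiMeasurePreserving_snd.ae hβK
          filter_upwards [h1, h2] with p h1 h2
          gcongr
          exact (enorm_sub_le).trans (add_le_add h1 h2)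
      _ = ((K : ℝ≥0∞) + K) ^ 2 * (ε * ε) := by
          rw [lintegral_const, ← univ_prod_univ, Measure.prod_prod, hα, hβ]
  rw [smul_eq_mul]
  calc ε⁻¹ * ∫⁻ p, ‖p.1 - p.2‖ₑ ^ 2 ∂(α.prod β)
      ≤ ε⁻¹ * (((K : ℝ≥0∞) + K) ^ 2 * (ε * ε)) := by gcongr
    _ = ((K : ℝ≥0∞) + K) ^ 2 * ((ε⁻¹ * ε) * ε) := by ring
    _ ≤ ((K : ℝ≥0∞) + K) ^ 2 * (1 * ε) := by gcongr; exact ENNReal.inv_mul_le_one ε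
    _ = _ := by rw [one_mul]

variable {ι : Type*} [Fintype ι]

/-- The finitely supported measure `∑ wᵢ δ_{xᵢ}`. -/
def diracSum (x : ι → Vec d) (w : ι → ℝ) : Measure (Vec d) :=
  ∑ i, ENNReal.ofReal (w i) • Measure.dirac (x i)

lemma lintegral_diracSum (x : ι → Vec d) (w : ι → ℝ) (f : Vec d → ℝ≥0∞) :
    ∫⁻ y, f y ∂(diracSum x w) = ∑ i, ENNReal.ofReal (w i) * f (x i) := by
  simp [diracSum, lintegral_finsetSum_measure]

lemma diracSum_univ (x : ι → Vec d) {w : ι → ℝ} (hw : ∀ i, 0 ≤ w i) :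
    diracSum x w univ = ENNReal.ofReal (∑ i, w i) := by
  rw [← lintegral_one, lintegral_diracSum, ENNReal.ofReal_sum_of_nonneg fun i _ => hw i]
  simp

lemma diracSum_add (x : ι → Vec d) {w w' : ι → ℝ} (hw : ∀ i, 0 ≤ w i) (hw' : ∀ i, 0 ≤ w' i) :
    diracSum x (fun i => w i + w' i) = diracSum x w + diracSum x w' := by
  simp only [diracSum, ← Finset.sum_add_distrib]
  exact Finset.sum_congr rfl fun i _ => by rw [ENNReal.ofReal_add (hw i) (hw' i), add_smul]

/-- The element `∑ pᵢ δ_{xᵢ}` of `𝒫₂`, for `p` in the standard simplex. -/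
def diracMix (x : ι → Vec d) (p : stdSimplex ℝ ι) : P2 d :=
  ⟨diracSum x p, ⟨by
    rw [diracSum_univ x (w := p) p.2.1, show ∑ i, p i = 1 from p.2.2, ENNReal.ofReal_one]⟩, by
    rw [secondMoment, lintegral_diracSum]
    exact ENNReal.sum_lt_top.2 fun i _ => ENNReal.mul_lt_top ENNReal.ofReal_lt_top
      (ENNReal.pow_lt_top enorm_lt_top)⟩

/-- The common part has weights `min (p i) (q i)`, and both remainders have the same mass since `p`
and `q` each sum to `1`. The bound tends to `0` as `p → q`, which makes `diracMix x` continuous on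
the simplex. -/
lemma exists_W2_diracMix_le (x : ι → Vec d) :
    ∃ K : ℝ≥0, ∀ p q : stdSimplex ℝ ι,
      W2 (diracMix x p) (diracMix x q) ≤ √((K + K) ^ 2 * ∑ i, max (p i - q i) 0) := by
  obtain ⟨K, hK⟩ : ∃ K : ℝ≥0, ∀ i, ‖x i‖ₑ ≤ K :=
    ⟨∑ i, ‖x i‖₊, fun i => by
      rw [enorm_eq_nnnorm]
      exact ENNReal.coe_le_coe.2
        (Finset.single_le_sum (f := fun i => ‖x i‖₊) (fun _ _ => zero_le) (Finset.mem_univ i))⟩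
  refine ⟨K, fun p q => ?_⟩
  have hsum : ∑ i, max (q i - p i) 0 = ∑ i, max (p i - q i) 0 := by
    rw [← sub_eq_zero, ← Finset.sum_sub_distrib]
    calc ∑ i, (max (q i - p i) 0 - max (p i - q i) 0) = ∑ i, (q i - p i) :=
          Finset.sum_congr rfl fun i _ => by
            rcases le_total (p i) (q i) with h | h
            · rw [max_eq_left (by linarith), max_eq_right (by linarith), sub_zero]
            · rw [max_eq_right (by linarith), max_eq_left (by linarith)]; ring
      _ = 0 := by
        rw [Finset.sum_sub_distrib]
        exact sub_eq_zero.2 (q.2.2.trans p.2.2.symm)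
  have hdec : ∀ p q : stdSimplex ℝ ι, (diracMix x p).toMeasure =
      diracSum x (fun i => min (p i) (q i)) + diracSum x (fun i => max (p i - q i) 0) := by
    intro p q
    rw [← diracSum_add x (w := fun i => min (p i) (q i)) (w' := fun i => max (p i - q i) 0)
      (fun i => le_min (p.2.1 i) (q.2.1 i)) (fun i => le_max_right _ _)]
    change diracSum x p = _
    congr 1
    funext i
    rcases le_total (p i) (q i) with h | h
    · rw [min_eq_left h, max_eq_right (by linarith), add_zero]
    · rw [min_eq_right h, max_eq_left (by linarith)]; ring
  have hfin : ∀ w : ι → ℝ, IsFiniteMeasure (diracSum x w) := fun w => by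
    refine ⟨?_⟩
    rw [← lintegral_one, lintegral_diracSum]
    exact ENNReal.sum_lt_top.2 fun i _ => by simp
  have hsupp : ∀ w : ι → ℝ, ∀ᵐ y ∂(diracSum x w), ‖y‖ₑ ≤ K := by
    intro w
    have hm : MeasurableSet {y : Vec d | ¬‖y‖ₑ ≤ K} :=
      (measurableSet_le measurable_enorm measurable_const).compl
    rw [ae_iff, ← lintegral_indicator_one hm, lintegral_diracSum]
    refine Finset.sum_eq_zero fun i _ => ?_
    rw [indicator_of_notMem (by simpa using hK i), mul_zero]
  have hq := hdec q p
  simp_rw [min_comm (q _) (p _)] at hq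
  have := transportCost_le_of_common_part (ε := ENNReal.ofReal (∑ i, max (p i - q i) 0)) (K := K)
    (hdec p q) hq (diracSum_univ x fun i => le_max_right _ _)
    ((diracSum_univ x fun i => le_max_right _ _).trans (by rw [hsum])) (hsupp _) (hsupp _)
  refine (W2_le_sqrt (by finiteness) this).trans (le_of_eq ?_)
  rw [ENNReal.toReal_mul, ENNReal.toReal_ofReal (Finset.sum_nonneg fun i _ => le_max_right _ _)]
  norm_cast

/-- A function on `𝒫₂` which is Lipschitz for `W2` is measurable along any measurable family of
measures. -/
theorem measurable_comp_of_W2_lipschitz {S : Type*} [MeasurableSpace S] {μ : S → P2 d}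
    (hμ : ∀ A, MeasurableSet A → Measurable fun s => (μ s).toMeasure A)
    {f : P2 d → Vec d} {L : ℝ} (hf : ∀ m n, ‖f m - f n‖ ≤ L * W2 m n) :
    Measurable fun s => f (μ s) := by
  -- Pushing `μ s` forward by `T n` gives a finitely supported measure with weights measurable in
  -- `s`, so measurability reduces to continuity on a simplex. The base point `0` yields `|x - T n
  -- x| ≤ |x|`, the domination that gives convergence in `W2`.
  let T : ℕ → SimpleFunc (Vec d) (Vec d) :=
    SimpleFunc.approxOn id measurable_id univ 0 (mem_univ _)
  have hT : ∀ x, Tendsto (fun n => T n x) atTop (𝓝 x) := fun x =>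
    SimpleFunc.tendsto_approxOn measurable_id (mem_univ _) (by simp)
  have hTle : ∀ n x, ‖x - T n x‖ₑ ≤ ‖x‖ₑ := by
    intro n x
    have := SimpleFunc.edist_approxOn_le measurable_id (mem_univ (0 : Vec d)) x n
    simpa [edist_comm, edist_eq_enorm_sub, T] using this
  have hprob := fun s => (μ s).isProbabilityMeasure
  let p : ∀ n, S → stdSimplex ℝ (T n).range := fun n s =>
    ⟨fun i => ((μ s).toMeasure ((T n) ⁻¹' {(i : Vec d)})).toReal,
      fun i => ENNReal.toReal_nonneg, by
        rw [← ENNReal.toReal_sum (fun i _ => measure_ne_top _ _),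
          Finset.sum_coe_sort (T n).range (fun i => (μ s).toMeasure ((T n) ⁻¹' {i})),
          SimpleFunc.sum_range_measure_preimage_singleton]
        simp⟩
  have hp : ∀ n, Measurable (p n) := fun n =>
    Measurable.subtype_mk (measurable_pi_lambda _ fun i =>
      (hμ _ ((T n).measurableSet_preimage _)).ennreal_toReal)
  have hcont : ∀ n, Continuous fun q : stdSimplex ℝ (T n).range =>
      f (diracMix (fun i : (T n).range => (i : Vec d)) q) := by
    intro n
    obtain ⟨K, hK⟩ := exists_W2_diracMix_le (fun i : (T n).range => (i : Vec d))
    rw [continuous_iff_continuousAt]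
    intro q
    rw [ContinuousAt, tendsto_iff_norm_sub_tendsto_zero]
    have hlim : Tendsto (fun q' : stdSimplex ℝ (T n).range =>
        |L| * √((K + K) ^ 2 * ∑ i, max (q' i - q i) 0)) (𝓝 q) (𝓝 0) := by
      have hc : Continuous fun q' : stdSimplex ℝ (T n).range =>
          |L| * √((K + K) ^ 2 * ∑ i, max (q' i - q i) 0) := by
        have : ∀ i, Continuous fun q' : stdSimplex ℝ (T n).range => q' i := fun i =>
          (continuous_apply i).comp continuous_subtype_val
        exact continuous_const.mul (Real.continuous_sqrt.comp (continuous_const.mul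
          (continuous_finsetSum _ fun i _ => ((this i).sub continuous_const).max continuous_const)))
      simpa using hc.tendsto q
    refine squeeze_zero (fun _ => norm_nonneg _) (fun q' => ?_) hlim
    refine (hf _ _).trans ?_
    refine mul_le_mul (le_abs_self L) (hK q' q) (W2_nonneg _ _) (abs_nonneg L)
  have hmap : ∀ n s, (diracMix (fun i : (T n).range => (i : Vec d)) (p n s)).toMeasure
      = (μ s).toMeasure.map (T n) := by
    intro n s
    ext A hA
    change diracSum _ _ A = _
    rw [← lintegral_indicator_one hA, lintegral_diracSum, ← lintegral_indicator_one hA,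
      lintegral_map (measurable_one.indicator hA) (T n).measurable]
    have h1 := SimpleFunc.map_lintegral (μ := (μ s).toMeasure)
      (A.indicator (1 : Vec d → ℝ≥0∞)) (T n)
    rw [← SimpleFunc.lintegral_eq_lintegral, ← Finset.sum_coe_sort] at h1
    refine Eq.trans ?_ h1.symm
    refine Finset.sum_congr rfl fun i _ => ?_
    rw [mul_comm]
    congr 1
    exact ENNReal.ofReal_toReal (measure_ne_top _ _)
  have hlim : ∀ s, Tendsto (fun n => f (diracMix (fun i : (T n).range => (i : Vec d)) (p n s)))
      atTop (𝓝 (f (μ s))) := by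
    intro s
    rw [tendsto_iff_norm_sub_tendsto_zero]
    let I : ℕ → ℝ≥0∞ := fun n => ∫⁻ x, ‖x - T n x‖ₑ ^ 2 ∂(μ s).toMeasure
    have hI : Tendsto I atTop (𝓝 0) := by
      have := tendsto_lintegral_of_dominated_convergence (μ := (μ s).toMeasure)
        (F := fun n x => ‖x - T n x‖ₑ ^ 2) (f := fun _ => 0) (fun x => ‖x‖ₑ ^ 2)
        (fun n => by
          have := (T n).measurable
          fun_prop)
        (fun n => Eventually.of_forall fun x => pow_le_pow_left₀ zero_le (hTle n x) 2)
        (μ s).2.2.ne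
        (Eventually.of_forall fun x => by
          have h1 : Tendsto (fun n => x - T n x) atTop (𝓝 0) := by
            simpa using (tendsto_const_nhds (x := x)).sub (hT x)
          have h2 := (ENNReal.continuous_pow 2).tendsto _ |>.comp (h1.enorm)
          simpa [Function.comp_def] using h2)
      simpa using this
    have hIfin : ∀ n, I n ≠ ∞ := fun n =>
      ((lintegral_mono fun x => pow_le_pow_left₀ zero_le (hTle n x) 2).trans_lt (μ s).2.2).ne
    have hW : ∀ n, W2 (diracMix (fun i : (T n).range => (i : Vec d)) (p n s)) (μ s)
        ≤ √(I n).toReal := by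
      intro n
      have hm : Measurable fun x => (T n x, x) := (T n).measurable.prodMk measurable_id
      have hπ : IsCoupling ((μ s).toMeasure.map fun x => (T n x, x))
          (diracMix (fun i : (T n).range => (i : Vec d)) (p n s)).toMeasure (μ s).toMeasure := by
        constructor
        · rw [Measure.map_map measurable_fst hm, hmap]; rfl
        · rw [Measure.map_map measurable_snd hm]; exact Measure.map_id
      refine W2_le_sqrt (hIfin n) ((transportCost_le hπ).trans (le_of_eq ?_))
      rw [lintegral_map (by fun_prop) hm]
      simp only [I, ← edist_eq_enorm_sub, edist_comm]
    have hsq : Tendsto (fun n => |L| * √(I n).toReal) atTop (𝓝 0) := by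
      have := ((ENNReal.tendsto_toReal ENNReal.zero_ne_top).comp hI).sqrt.const_mul |L|
      simpa using this
    refine squeeze_zero (fun _ => norm_nonneg _) (fun n => ?_) hsq
    exact (hf _ _).trans (mul_le_mul (le_abs_self L) (hW n) (W2_nonneg _ _) (abs_nonneg L))
  exact measurable_of_tendsto_metrizable (fun n => (hcont n).measurable.comp (hp n))
    (tendsto_pi_nhds.2 hlim)

end Wasserstein

/-! ### Measurability of the kernel, the averages and the drift. -/

/-- The hypothesis covers continuous integrands only. The indicator of `Iic a` is a limit of such
functions, and these half-lines form a π-system generating the Borel sets. -/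
lemma IsMemoryKernel.measurable_measure {R : ℝ≥0 → Measure ℝ≥0} (hR : IsMemoryKernel R) :
    Measurable R := by
  have hprob := hR.prob
  refine .measure_of_isPiSystem_of_isProbabilityMeasure (borel_eq_generateFrom_Iic ℝ≥0 ▸
    BorelSpace.measurable_eq) isPiSystem_Iic ?_
  rintro _ ⟨a, rfl⟩
  have hcl : IsClosed (Iic a) := isClosed_Iic
  refine measurable_of_tendsto_metrizable (f := fun n t => ∫⁻ x, hcl.apprSeq n x ∂(R t))
    (fun n => ?_) (tendsto_pi_nhds.2 fun t => HasOuterApproxClosed.tendsto_lintegral_apprSeq hcl (R t))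
  have h1 := (hR.measurable (fun x => (hcl.apprSeq n x : ℝ))
    (NNReal.continuous_coe.comp (hcl.apprSeq n).continuous)).ennreal_ofReal
  convert h1 using 2 with t
  rw [Measure.restrict_eq_self_of_ae_mem (s := Iic t) (hR.ae_le t), ofReal_integral_eq_lintegral_ofReal]
  · simp
  · exact BoundedContinuousFunction.integrable (R t)
      ((hcl.apprSeq n).comp _ NNReal.isometry_coe.lipschitz)
  · exact Eventually.of_forall fun x => NNReal.coe_nonneg _

/-- If `m` is a measurable family of measures, then so is the family of its averages along `R`. -/
lemma IsMemoryKernel.measurable_average {d : ℕ} {R : ℝ≥0 → Measure ℝ≥0} (hR : IsMemoryKernel R)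
    {μ m : ℝ≥0 → P2 d}
    (hm : ∀ A, MeasurableSet A → Measurable fun s => (m s).toMeasure A)
    (hμ : ∀ t A, MeasurableSet A →
      (μ t).toMeasure A = ∫⁻ s in Iic t, (m s).toMeasure A ∂(R t)) {A : Set (Vec d)}
    (hA : MeasurableSet A) : Measurable fun t => (μ t).toMeasure A := by
  have h : (fun t => (μ t).toMeasure A) = fun t => ∫⁻ s, (m s).toMeasure A ∂(R t) := by
    funext t
    rw [hμ t A hA, Measure.restrict_eq_self_of_ae_mem (s := Iic t) (hR.ae_le t)]
  rw [h]
  exact (Measure.measurable_lintegral (hm A hA)).comp hR.measurable_measure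

/-- The drift along a measurable flow of measures is jointly measurable. -/
lemma DriftCondition.measurable_drift {d : ℕ} {a : Vec d → Vec d} {b : Vec d → P2 d → Vec d}
    {ρ κ : ℝ} (h : DriftCondition a b ρ κ) {μ : ℝ≥0 → P2 d}
    (hμ : ∀ A, MeasurableSet A → Measurable fun s => (μ s).toMeasure A) :
    Measurable fun q : Vec d × ℝ≥0 => a q.1 + b q.1 (μ q.2) := by
  obtain ⟨L, hL⟩ := h.lip
  have hW : ∀ m : P2 d, W2 m m = 0 := by
    intro m
    have hm : Measurable fun x : Vec d => (x, x) := by fun_prop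
    have hπ : IsCoupling (m.toMeasure.map fun x => (x, x)) m.toMeasure m.toMeasure := by
      constructor
      · rw [Measure.map_map measurable_fst hm]; exact Measure.map_id
      · rw [Measure.map_map measurable_snd hm]; exact Measure.map_id
    have h0 : transportCost m m ≤ 0 := by
      refine (transportCost_le hπ).trans (le_of_eq ?_)
      rw [lintegral_map (by fun_prop) hm]
      simp
    rw [W2, nonpos_iff_eq_zero.1 h0]
    simp
  -- Carathéodory: continuity in position and measurability in time give joint measurability.
  have hb : Measurable (Function.uncurry fun (y : Vec d) (s : ℝ≥0) => b y (μ s)) := by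
    refine measurable_uncurry_of_continuous_of_measurable (fun s => ?_) fun y => ?_
    · refine LipschitzWith.continuous (K := L) (LipschitzWith.of_dist_le_mul fun z y => ?_)
      simpa [dist_eq_norm, hW] using hL z y (μ s) (μ s)
    · exact measurable_comp_of_W2_lipschitz hμ (f := b y) (L := L) fun m n => by
        simpa using hL y y m n
  exact (h.locLip.continuous.measurable.comp measurable_fst).add hb

/-! ### Paths sampled at countably many times. -/

section PathSpace

variable {d : ℕ}

/-- Paths sampled at the rational times `k / (n + 1)`. -/
abbrev GridPath (d : ℕ) : Type := ℕ × ℕ → Vec d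

/-- The sampling time indexed by `(k, n)`. -/
def gridTime (p : ℕ × ℕ) : ℝ≥0 := p.1 / (p.2 + 1)

/-- The values of a path at the sampling times. -/
def sample (x : ℝ≥0 → Vec d) : GridPath d := fun p => x (gridTime p)

/-- The last sampling time of mesh `1 / (n + 1)` before `t`. -/
def gridIndex (n : ℕ) (t : ℝ≥0) : ℕ × ℕ := (⌊(t : ℝ) * (n + 1)⌋₊, n)

/-- The path reconstructed from its values at the sampling times. -/
def reconstruct (y : GridPath d) (t : ℝ≥0) : Vec d :=
  limUnder atTop fun n => y (gridIndex n t)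

lemma tendsto_gridTime_gridIndex (t : ℝ≥0) :
    Tendsto (fun n => gridTime (gridIndex n t)) atTop (𝓝 t) := by
  rw [← NNReal.tendsto_coe]
  have h := (tendsto_nat_floor_mul_div_atTop t.2).comp
    ((tendsto_natCast_atTop_atTop (R := ℝ)).comp (tendsto_add_atTop_nat 1))
  simpa [Function.comp_def, gridTime, gridIndex] using h

lemma tendsto_sample_gridIndex {x : ℝ≥0 → Vec d} (hx : Continuous x) (t : ℝ≥0) :
    Tendsto (fun n => sample x (gridIndex n t)) atTop (𝓝 (x t)) :=
  (hx.tendsto t).comp (tendsto_gridTime_gridIndex t)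

lemma reconstruct_sample {x : ℝ≥0 → Vec d} (hx : Continuous x) (t : ℝ≥0) :
    reconstruct (sample x) t = x t :=
  (tendsto_sample_gridIndex hx t).limUnder_eq

lemma measurable_eval_gridIndex (n : ℕ) :
    Measurable fun q : GridPath d × ℝ≥0 => q.1 (gridIndex n q.2) := by
  have h1 : Measurable fun q : GridPath d × (ℕ × ℕ) => q.1 q.2 :=
    measurable_from_prod_countable_left fun p => measurable_pi_apply p
  have h2 : Measurable fun t : ℝ≥0 => gridIndex n t :=
    (Nat.measurable_floor.comp (NNReal.continuous_coe.measurable.mul_const _)).prodMk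
      measurable_const
  exact h1.comp (measurable_fst.prodMk (h2.comp measurable_snd))

lemma measurable_reconstruct :
    Measurable fun q : GridPath d × ℝ≥0 => reconstruct q.1 q.2 :=
  (StronglyMeasurable.limUnder fun n => (measurable_eval_gridIndex n).stronglyMeasurable).measurable

lemma measurable_reconstruct_left (t : ℝ≥0) :
    Measurable fun y : GridPath d => reconstruct y t :=
  measurable_reconstruct.comp (measurable_id.prodMk measurable_const)

/-- The sampled path `y` converges to its reconstruction at time `t`. -/
def ConvergesAt (y : GridPath d) (t : ℝ≥0) : Prop :=
  Tendsto (fun n => y (gridIndex n t)) atTop (𝓝 (reconstruct y t))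

/-- `limUnder` takes an arbitrary value when there is no limit. The existential form is the one
whose measurability follows from that of the approximations. -/
lemma convergesAt_iff (y : GridPath d) (t : ℝ≥0) :
    ConvergesAt y t ↔ ∃ c, Tendsto (fun n => y (gridIndex n t)) atTop (𝓝 c) :=
  ⟨fun h => ⟨_, h⟩, fun h => tendsto_nhds_limUnder h⟩

lemma convergesAt_sample {x : ℝ≥0 → Vec d} (hx : Continuous x) (t : ℝ≥0) :
    ConvergesAt (sample x) t :=
  (convergesAt_iff _ _).2 ⟨_, tendsto_sample_gridIndex hx t⟩

lemma measurableSet_convergesAt :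
    MeasurableSet {q : GridPath d × ℝ≥0 | ConvergesAt q.1 q.2} := by
  simp_rw [convergesAt_iff]
  exact MeasureTheory.measurableSet_exists_tendsto measurable_eval_gridIndex

/-- The drift along a reconstructed path. -/
def pathDrift (F : Vec d × ℝ≥0 → Vec d) (y : GridPath d) (s : ℝ) : Vec d :=
  F (reconstruct y s.toNNReal, s.toNNReal)

lemma measurable_pathDrift {F : Vec d × ℝ≥0 → Vec d} (hF : Measurable F) :
    Measurable fun q : GridPath d × ℝ => pathDrift F q.1 q.2 := by
  have h : Measurable fun q : GridPath d × ℝ => q.2.toNNReal := measurable_snd.real_toNNReal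
  exact hF.comp ((measurable_reconstruct.comp (measurable_fst.prodMk h)).prodMk h)

/-- The sampled path `y` solves `y_t = x + ∫₀ᵗ F(y_s, s) ds + A w_t` at all sampling times. -/
structure IsDriven (F : Vec d × ℝ≥0 → Vec d) (A : Vec d →L[ℝ] Vec d) (x : Vec d)
    (w y : GridPath d) : Prop where
  integrable : ∀ p, IntegrableOn (pathDrift F y) (Ioc 0 (gridTime p : ℝ))
  equation : ∀ p, y p = x + (∫ s in Ioc 0 (gridTime p : ℝ), pathDrift F y s) + A (w p)
  converges : ∀ᵐ s : ℝ, ConvergesAt y s.toNNReal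

/-- This lets the equation travel from a solution to its law, and from there to any space carrying
that law. Only countably many times occur, apart from one almost-everywhere condition handled by
sections. -/
lemma measurableSet_isDriven {F : Vec d × ℝ≥0 → Vec d} (hF : Measurable F)
    (A : Vec d →L[ℝ] Vec d) :
    MeasurableSet {q : (Vec d × GridPath d) × GridPath d | IsDriven F A q.1.1 q.1.2 q.2} := by
  have hD := (measurable_pathDrift hF).stronglyMeasurable
  have h1 : MeasurableSet {y : GridPath d |
      ∀ p, IntegrableOn (pathDrift F y) (Ioc 0 (gridTime p : ℝ))} := by
    simp only [ofPred_forall]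
    exact MeasurableSet.iInter fun p => measurableSet_integrable hD
  have h2 : MeasurableSet {q : (Vec d × GridPath d) × GridPath d | ∀ p,
      q.2 p = q.1.1 + (∫ s in Ioc 0 (gridTime p : ℝ), pathDrift F q.2 s) + A (q.1.2 p)} := by
    simp only [ofPred_forall]
    refine MeasurableSet.iInter fun p => measurableSet_eq_fun (by fun_prop) ?_
    have hI : Measurable fun y : GridPath d =>
        ∫ s in Ioc 0 (gridTime p : ℝ), pathDrift F y s :=
      (hD.integral_prod_right (ν := volume.restrict (Ioc 0 (gridTime p : ℝ)))).measurable
    have hw : Measurable fun q : (Vec d × GridPath d) × GridPath d => q.1.2 p := by fun_prop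
    exact ((measurable_fst.comp measurable_fst).add (hI.comp measurable_snd)).add
      (A.measurable.comp hw)
  have h3 : MeasurableSet {y : GridPath d | ∀ᵐ s : ℝ, ConvergesAt y s.toNNReal} := by
    have hC : MeasurableSet {q : GridPath d × ℝ | ConvergesAt q.1 q.2.toNNReal} :=
      measurableSet_convergesAt.preimage
        (measurable_fst.prodMk (measurable_snd.real_toNNReal))
    exact measurableSet_eq_fun (measurable_measure_prodMk_left (ν := volume) hC.compl)
      measurable_const
  have : {q : (Vec d × GridPath d) × GridPath d | IsDriven F A q.1.1 q.1.2 q.2} =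
      Prod.snd ⁻¹' {y : GridPath d | ∀ p, IntegrableOn (pathDrift F y) (Ioc 0 (gridTime p : ℝ))} ∩
      {q : (Vec d × GridPath d) × GridPath d | ∀ p,
        q.2 p = q.1.1 + (∫ s in Ioc 0 (gridTime p : ℝ), pathDrift F q.2 s) + A (q.1.2 p)} ∩
      Prod.snd ⁻¹' {y : GridPath d | ∀ᵐ s : ℝ, ConvergesAt y s.toNNReal} := by
    ext q
    exact ⟨fun h => ⟨⟨h.1, h.2⟩, h.3⟩, fun h => ⟨h.1.1, h.1.2, h.2⟩⟩
  rw [this]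
  exact ((h1.preimage measurable_snd).inter h2).inter (h3.preimage measurable_snd)

/-- Two driven paths with the same noise: their difference is the integral of the difference of
the drifts. -/
lemma IsDriven.sub_eq {F F' : Vec d × ℝ≥0 → Vec d} {A : Vec d →L[ℝ] Vec d} {x x' : Vec d}
    {w y y' : GridPath d} (h : IsDriven F A x w y) (h' : IsDriven F' A x' w y') {t : ℝ≥0}
    (ht : ConvergesAt y t) (ht' : ConvergesAt y' t) :
    reconstruct y t - reconstruct y' t =
      x - x' + ∫ s in (0 : ℝ)..t, (pathDrift F y s - pathDrift F' y' s) := by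
  have hint : ∀ p, IntegrableOn (fun s => pathDrift F y s - pathDrift F' y' s)
      (Ioc 0 (gridTime p : ℝ)) := fun p => (h.integrable p).sub (h'.integrable p)
  obtain ⟨N, hN⟩ := exists_nat_gt t
  have hgt : gridTime (N, 0) = N := by simp [gridTime]
  have hN' : IntervalIntegrable (fun s => pathDrift F y s - pathDrift F' y' s) volume 0 N := by
    rw [intervalIntegrable_iff_integrableOn_Ioc_of_le (by positivity)]
    simpa [hgt] using hint (N, 0)
  have hcont := intervalIntegral.continuousOn_primitive_interval'
    hN' (left_mem_uIcc)
  have htN : (t : ℝ) < N := by exact_mod_cast hN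
  have hlim : Tendsto (fun n => ((gridTime (gridIndex n t) : ℝ≥0) : ℝ)) atTop
      (𝓝[uIcc (0 : ℝ) N] (t : ℝ)) := by
    refine tendsto_nhdsWithin_iff.2
      ⟨(NNReal.continuous_coe.tendsto t).comp (tendsto_gridTime_gridIndex t), ?_⟩
    filter_upwards [(tendsto_gridTime_gridIndex t).eventually (gt_mem_nhds hN)] with n hn
    rw [uIcc_of_le (by positivity)]
    exact ⟨NNReal.coe_nonneg _, by exact_mod_cast hn.le⟩
  have h1 := ((hcont t (by rw [uIcc_of_le (by positivity)]; exact ⟨t.2, htN.le⟩)).tendsto.comp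
    hlim).const_add (x - x')
  -- The noise cancels at grid times before the limit is taken, so convergence of the sampled noise
  -- is never needed.
  refine tendsto_nhds_unique (ht.sub ht') (h1.congr fun n => ?_)
  simp only [Function.comp]
  rw [intervalIntegral.integral_of_le (NNReal.coe_nonneg _),
    integral_sub (h.integrable _) (h'.integrable _), h.equation, h'.equation]
  abel

end PathSpace

/-! ### Gluing along conditional laws. -/

/-- Given `t`, the second component has the conditional law prescribed by `l` at `f t`, so
disintegration rebuilds `l`. -/
lemma map_compProd_eq_of_condKernel {T A Y Z : Type*} [MeasurableSpace T] [MeasurableSpace A]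
    [MeasurableSpace Y] [MeasurableSpace Z] [StandardBorelSpace Y] [Nonempty Y]
    (ν : Measure T) [IsProbabilityMeasure ν] {f : T → A} (hf : Measurable f)
    (l : Measure (A × Y)) [IsFiniteMeasure l] (hl : l.fst = ν.map f) (K : Kernel T Z)
    [IsMarkovKernel K] {g : Z → Y} (hg : Measurable g)
    (hK : ∀ t, (K t).map g = l.condKernel (f t)) :
    (ν ⊗ₘ K).map (fun q => (f q.1, g q.2)) = l := by
  have hm : Measurable fun q : T × Z => (f q.1, g q.2) := by fun_prop
  ext S hS
  rw [Measure.map_apply hm hS, Measure.compProd_apply (hm hS)]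
  have h3 : l S = ∫⁻ t, l.condKernel (f t) (Prod.mk (f t) ⁻¹' S) ∂ν := by
    conv_lhs => rw [← l.disintegrate l.condKernel, hl, Measure.compProd_apply hS]
    rw [lintegral_map (Kernel.measurable_kernel_prodMk_left hS) hf]
  rw [h3]
  refine lintegral_congr fun t => ?_
  rw [← hK t, Measure.map_apply hg (measurable_prodMk_left hS)]
  rfl

/-- Gluing: two laws on `A₁ × Y₁` and `A₂ × Y₂` can be realized jointly over a common space `T`
which carries their first marginals. -/
theorem exists_gluing {T A₁ A₂ Y₁ Y₂ : Type*} [MeasurableSpace T] [MeasurableSpace A₁]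
    [MeasurableSpace A₂] [MeasurableSpace Y₁] [MeasurableSpace Y₂] [StandardBorelSpace Y₁]
    [StandardBorelSpace Y₂] [Nonempty Y₁] [Nonempty Y₂] (ν : Measure T) [IsProbabilityMeasure ν]
    {f₁ : T → A₁} {f₂ : T → A₂} (hf₁ : Measurable f₁) (hf₂ : Measurable f₂)
    (l₁ : Measure (A₁ × Y₁)) (l₂ : Measure (A₂ × Y₂)) [IsFiniteMeasure l₁] [IsFiniteMeasure l₂]
    (h₁ : l₁.fst = ν.map f₁) (h₂ : l₂.fst = ν.map f₂) :
    ∃ Θ : Measure (T × (Y₁ × Y₂)), IsProbabilityMeasure Θ ∧ Θ.map Prod.fst = ν ∧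
      Θ.map (fun q => (f₁ q.1, q.2.1)) = l₁ ∧ Θ.map (fun q => (f₂ q.1, q.2.2)) = l₂ := by
  -- The two components are made conditionally independent given the point of `T`.
  let K : Kernel T (Y₁ × Y₂) := (l₁.condKernel.comap f₁ hf₁) ×ₖ (l₂.condKernel.comap f₂ hf₂)
  refine ⟨ν ⊗ₘ K, inferInstance, Measure.fst_compProd ν K,
    map_compProd_eq_of_condKernel ν hf₁ l₁ h₁ K measurable_fst fun t => ?_,
    map_compProd_eq_of_condKernel ν hf₂ l₂ h₂ K measurable_snd fun t => ?_⟩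
  · simp only [K, Kernel.prod_apply, Kernel.comap_apply, Measure.map_fst_prod]
    simp
  · simp only [K, Kernel.prod_apply, Kernel.comap_apply, Measure.map_snd_prod]
    simp

/-! ### Uniqueness of the law of Brownian motion. -/

section BrownianLaw

variable {d : ℕ} {Ω Ω' : Type*} [MeasurableSpace Ω] [MeasurableSpace Ω'] {P : Measure Ω}
  {P' : Measure Ω'}

/-- Both laws are projective limits of the same finite-dimensional laws, and such a limit is unique.
-/
lemma isBrownianReal_map_eq [IsProbabilityMeasure P] [IsProbabilityMeasure P']
    {B : ℝ≥0 → Ω → ℝ} {B' : ℝ≥0 → Ω' → ℝ} (h : IsBrownianReal B P) (h' : IsBrownianReal B' P')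
    (hB : ∀ t, Measurable (B t)) (hB' : ∀ t, Measurable (B' t)) :
    P.map (fun ω t => B t ω) = P'.map (fun ω t => B' t ω) := by
  have h1 := isProjectiveLimit_map (X := B) (P := P) (measurable_pi_lambda _ hB).aemeasurable
  have h2 := isProjectiveLimit_map (X := B') (P := P') (measurable_pi_lambda _ hB').aemeasurable
  have e : ∀ I : Finset ℝ≥0, P.map (fun ω => I.restrict (B · ω)) =
      P'.map (fun ω => I.restrict (B' · ω)) := fun I =>
    (h.hasLaw I).map_eq.trans (h'.hasLaw I).map_eq.symm
  simp_rw [e] at h1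
  exact h1.unique h2

/-- All standard Brownian motions on `ℝ^d` have the same law. -/
lemma isBrownianVec_map_eq [IsProbabilityMeasure P] [IsProbabilityMeasure P']
    {B : ℝ≥0 → Ω → Vec d} {B' : ℝ≥0 → Ω' → Vec d} (h : IsBrownianVec B P)
    (h' : IsBrownianVec B' P') :
    P.map (fun ω t => B t ω) = P'.map (fun ω t => B' t ω) := by
  have hm : ∀ i t, Measurable fun ω => B t ω i := fun i t =>
    (EuclideanSpace.proj (𝕜 := ℝ) i).measurable.comp (h.measurable t)
  have hm' : ∀ i t, Measurable fun ω => B' t ω i := fun i t =>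
    (EuclideanSpace.proj (𝕜 := ℝ) i).measurable.comp (h'.measurable t)
  have e := (iIndepFun_iff_map_fun_eq_pi_map
    (fun i => (measurable_pi_lambda _ (hm i)).aemeasurable)).1 h.indep
  have e' := (iIndepFun_iff_map_fun_eq_pi_map
    (fun i => (measurable_pi_lambda _ (hm' i)).aemeasurable)).1 h'.indep
  have hcoord : ∀ i, P.map (fun ω t => B t ω i) = P'.map (fun ω t => B' t ω i) := fun i =>
    isBrownianReal_map_eq (h.coord i) (h'.coord i) (hm i) (hm' i)
  simp_rw [hcoord, ← e'] at e
  let G : (Fin d → ℝ≥0 → ℝ) → ℝ≥0 → Vec d := fun f t => WithLp.toLp 2 fun i => f i t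
  have hG : Measurable G := by
    refine measurable_pi_lambda _ fun t => ?_
    exact (MeasurableEquiv.toLp 2 (Fin d → ℝ)).measurable.comp
      (measurable_pi_lambda _ fun i => (measurable_pi_apply t).comp (measurable_pi_apply i))
  have e2 := congrArg (Measure.map G) e
  rw [Measure.map_map hG (measurable_pi_lambda _ fun i => measurable_pi_lambda _ (hm i)),
    Measure.map_map hG (measurable_pi_lambda _ fun i => measurable_pi_lambda _ (hm' i))] at e2
  exact e2

end BrownianLaw

/-! ### Pathwise contraction under a common noise. -/

section PathComparison

variable {d : ℕ}

lemma IsDriven.intervalIntegrable {F : Vec d × ℝ≥0 → Vec d} {A : Vec d →L[ℝ] Vec d} {x : Vec d}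
    {w y : GridPath d} (h : IsDriven F A x w y) {s t : ℝ} (hs : 0 ≤ s) (hst : s ≤ t) :
    IntervalIntegrable (pathDrift F y) volume s t := by
  obtain ⟨N, hN⟩ := exists_nat_gt t
  have hgt : gridTime (N, 0) = N := by simp [gridTime]
  rw [intervalIntegrable_iff_integrableOn_Ioc_of_le hst]
  refine (h.integrable (N, 0)).mono_set ?_
  rw [hgt]
  exact Ioc_subset_Ioc hs (by simpa using hN.le)

/-- Pathwise contraction of two solutions driven by the same noise. -/
lemma DriftCondition.path_contraction {a : Vec d → Vec d} {b : Vec d → P2 d → Vec d} {ρ κ : ℝ}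
    (hab : DriftCondition a b ρ κ) (hρ : 0 < ρ) (hκ : 0 ≤ κ) {μ μ' : ℝ≥0 → P2 d}
    {A : Vec d →L[ℝ] Vec d}
    {x x' : Vec d} {w y y' : GridPath d}
    (h : IsDriven (fun q => a q.1 + b q.1 (μ q.2)) A x w y)
    (h' : IsDriven (fun q => a q.1 + b q.1 (μ' q.2)) A x' w y') {s t : ℝ≥0} (hst : s ≤ t) {D : ℝ}
    (hD : ∀ r ∈ Icc s t, W2 (μ' r) (μ r) ^ 2 ≤ D)
    (hs : ConvergesAt y s) (hs' : ConvergesAt y' s) (ht : ConvergesAt y t)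
    (ht' : ConvergesAt y' t) :
    Real.exp (2 * ρ * t) * (‖reconstruct y t - reconstruct y' t‖ ^ 2 - κ / ρ * D) ≤
      Real.exp (2 * ρ * s) * (‖reconstruct y s - reconstruct y' s‖ ^ 2 - κ / ρ * D) := by
  set F : Vec d × ℝ≥0 → Vec d := fun q => a q.1 + b q.1 (μ q.2) with hF
  set F' : Vec d × ℝ≥0 → Vec d := fun q => a q.1 + b q.1 (μ' q.2) with hF'
  have hint : ∀ {p q : ℝ}, 0 ≤ p → p ≤ q →
      IntervalIntegrable (fun r => pathDrift F y r - pathDrift F' y' r) volume p q :=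
    fun hp hpq => (h.intervalIntegrable hp hpq).sub (h'.intervalIntegrable hp hpq)
  have hst' : (s : ℝ) ≤ t := by exact_mod_cast hst
  rw [h.sub_eq h' ht ht', h.sub_eq h' hs hs']
  -- The level is `K = κ / ρ * D`, for which `-ρ |z|² + κ D = ρ (K - |z|²)`.
  refine exp_mul_norm_sq_sub_le
    (z := fun r : ℝ => x - x' + ∫ q in (0 : ℝ)..r, (pathDrift F y q - pathDrift F' y' q)) hst'
    (hint s.2 hst') (fun r hr => ?_) ?_
  · rw [add_assoc, intervalIntegral.integral_add_adjacent_intervals (hint le_rfl s.coe_nonneg)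
      (hint s.coe_nonneg hr.1)]
  · filter_upwards [h.converges, h'.converges] with r hr hr' hrst
    have hr0 : 0 ≤ r := s.2.trans hrst.1
    have heq := h.sub_eq h' hr hr'
    rw [Real.coe_toNNReal r hr0] at heq
    rw [← heq]
    have hmem : r.toNNReal ∈ Icc s t := by
      constructor
      · exact NNReal.le_toNNReal_of_coe_le hrst.1
      · exact Real.toNNReal_le_iff_le_coe.2 hrst.2
    have hc := hab.contract (reconstruct y r.toNNReal) (reconstruct y' r.toNNReal)
      (μ r.toNNReal) (μ' r.toNNReal)
    have hu : pathDrift F y r - pathDrift F' y' r =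
        a (reconstruct y r.toNNReal) + b (reconstruct y r.toNNReal) (μ r.toNNReal)
          - a (reconstruct y' r.toNNReal) - b (reconstruct y' r.toNNReal) (μ' r.toNNReal) := by
      simp only [pathDrift, hF, hF']
      abel
    rw [hu]
    have h1 := mul_le_mul_of_nonneg_left (hD _ hmem) hκ
    have h2 : ρ * (κ / ρ * D) = κ * D := by field_simp
    rw [mul_sub, h2]
    linarith

end PathComparison

/-! ### Laws of solutions and their synchronous coupling. -/

section Solution

variable {d : ℕ} {a : Vec d → Vec d} {b : Vec d → P2 d → Vec d} {M : Matrix (Fin d) (Fin d) ℝ}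
  {R : ℝ≥0 → Measure ℝ≥0} {σ : ℝ} {Ω : Type*} [MeasurableSpace Ω] {P : Measure Ω}
  {B X : ℝ≥0 → Ω → Vec d} {μ m : ℝ≥0 → P2 d}

lemma measurable_sample {X : ℝ≥0 → Ω → Vec d} (hX : ∀ t, Measurable (X t)) :
    Measurable fun ω => sample fun t => X t ω :=
  measurable_pi_lambda _ fun _ => hX _

lemma IsSolution.map_reconstruct (h : IsSolution a b M R σ P B X μ m) (t : ℝ≥0) :
    P.map (fun ω => reconstruct (sample fun s => X s ω) t) = (m t).toMeasure := by
  rw [← h.law t]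
  refine Measure.map_congr ?_
  filter_upwards [h.continuous] with ω hω using reconstruct_sample hω t

/-- `X` is measurable only at each fixed time. Its reconstruction from samples is jointly measurable
and has the same one-time laws. -/
lemma IsSolution.measurable_law [IsProbabilityMeasure P] (h : IsSolution a b M R σ P B X μ m)
    {A : Set (Vec d)} (hA : MeasurableSet A) : Measurable fun t => (m t).toMeasure A := by
  have hj : Measurable fun q : Ω × ℝ≥0 => reconstruct (sample fun s => X s q.1) q.2 :=
    measurable_reconstruct.comp
      (((measurable_sample h.measurable).comp measurable_fst).prodMk measurable_snd)
  have he : (fun t => (m t).toMeasure A) =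
      fun t => P ((fun ω => (ω, t)) ⁻¹' ((fun q : Ω × ℝ≥0 =>
        reconstruct (sample fun s => X s q.1) q.2) ⁻¹' A)) := by
    funext t
    have ht : Measurable fun ω => reconstruct (sample fun s => X s ω) t :=
      (measurable_reconstruct_left t).comp (measurable_sample h.measurable)
    rw [← h.map_reconstruct t, Measure.map_apply ht hA]
    rfl
  rw [he]
  exact measurable_measure_prodMk_right (hj hA)

lemma IsSolution.isDriven (h : IsSolution a b M R σ P B X μ m) :
    ∀ᵐ ω ∂P, IsDriven (fun q => a q.1 + b q.1 (μ q.2)) (σ • Matrix.toEuclideanCLM (𝕜 := ℝ) M)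
      (X 0 ω) (sample fun t => B t ω) (sample fun t => X t ω) := by
  filter_upwards [h.continuous, h.integrable, h.equation] with ω hc hi he
  have hpd : pathDrift (fun q => a q.1 + b q.1 (μ q.2)) (sample fun t => X t ω) =
      fun s : ℝ => a (X s.toNNReal ω) + b (X s.toNNReal ω) (μ s.toNNReal) := by
    funext s
    simp only [pathDrift, reconstruct_sample hc]
  refine ⟨fun p => ?_, fun p => ?_, Eventually.of_forall fun s => convergesAt_sample hc _⟩
  · rw [hpd]
    exact (intervalIntegrable_iff_integrableOn_Ioc_of_le (NNReal.coe_nonneg _)).1 (hi _)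
  · rw [hpd, ← intervalIntegral.integral_of_le (NNReal.coe_nonneg _)]
    exact he (gridTime p)

/-- The joint law of the initial position, the sampled noise and the sampled solution. -/
def solutionLaw (P : Measure Ω) (B X : ℝ≥0 → Ω → Vec d) :
    Measure ((Vec d × GridPath d) × GridPath d) :=
  P.map fun ω => ((X 0 ω, sample fun t => B t ω), sample fun t => X t ω)

lemma IsSolution.measurable_triple (h : IsSolution a b M R σ P B X μ m) :
    Measurable fun ω => ((X 0 ω, sample fun t => B t ω), sample fun t => X t ω) :=
  ((h.measurable 0).prodMk (measurable_sample h.brownian.measurable)).prodMk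
    (measurable_sample h.measurable)

/-- Independence of the initial position and the noise makes this marginal a product, so the noises
can be identified while the initial positions are coupled freely. -/
lemma IsSolution.fst_solutionLaw [IsProbabilityMeasure P] (h : IsSolution a b M R σ P B X μ m) :
    (solutionLaw P B X).fst =
      (m 0).toMeasure.prod (P.map fun ω => sample fun t => B t ω) := by
  have hs : Measurable fun w : ℝ≥0 → Vec d => sample w :=
    measurable_pi_lambda _ fun _ => measurable_pi_apply _
  have hi : IndepFun (X 0) (fun ω => sample fun t => B t ω) P :=
    h.indep.comp measurable_id hs
  rw [Measure.fst, solutionLaw, Measure.map_map measurable_fst h.measurable_triple, ← h.law 0]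
  exact (indepFun_iff_map_prod_eq_prod_map_map (h.measurable 0).aemeasurable
    (measurable_sample h.brownian.measurable).aemeasurable).1 hi

lemma IsSolution.ae_solutionLaw (h : IsSolution a b M R σ P B X μ m)
    (hF : Measurable fun q : Vec d × ℝ≥0 => a q.1 + b q.1 (μ q.2)) :
    ∀ᵐ q ∂(solutionLaw P B X), IsDriven (fun q => a q.1 + b q.1 (μ q.2))
      (σ • Matrix.toEuclideanCLM (𝕜 := ℝ) M) q.1.1 q.1.2 q.2 :=
  (ae_map_iff h.measurable_triple.aemeasurable (measurableSet_isDriven hF _)).2 h.isDriven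

lemma IsSolution.ae_solutionLaw_zero (h : IsSolution a b M R σ P B X μ m) :
    ∀ᵐ q ∂(solutionLaw P B X), reconstruct q.2 0 = q.1.1 := by
  refine (ae_map_iff h.measurable_triple.aemeasurable (measurableSet_eq_fun
    ((measurable_reconstruct_left 0).comp measurable_snd) (by fun_prop))).2 ?_
  filter_upwards [h.continuous] with ω hω using reconstruct_sample hω 0

lemma IsSolution.ae_solutionLaw_convergesAt (h : IsSolution a b M R σ P B X μ m) (t : ℝ≥0) :
    ∀ᵐ q ∂(solutionLaw P B X), ConvergesAt q.2 t := by
  refine (ae_map_iff h.measurable_triple.aemeasurable (measurableSet_convergesAt.preimage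
    (measurable_snd.prodMk measurable_const))).2 ?_
  filter_upwards [h.continuous] with ω hω using convergesAt_sample hω t

lemma measurable_reconstruct_snd {T : Type*} [MeasurableSpace T] (t : ℝ≥0) :
    Measurable fun q : T × GridPath d => reconstruct q.2 t :=
  (measurable_reconstruct_left t).comp measurable_snd

lemma IsSolution.map_solutionLaw (h : IsSolution a b M R σ P B X μ m) (t : ℝ≥0) :
    (solutionLaw P B X).map (fun q => reconstruct q.2 t) = (m t).toMeasure := by
  rw [solutionLaw, Measure.map_map (measurable_reconstruct_snd t) h.measurable_triple,
    ← h.map_reconstruct t]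
  rfl

variable {Ω' : Type*} [MeasurableSpace Ω'] {P' : Measure Ω'}
  {B' X' : ℝ≥0 → Ω' → Vec d} {μ' m' : ℝ≥0 → P2 d} {ρ κ : ℝ}

set_option maxHeartbeats 1000000 in
/-- Synchronous coupling: two solutions can be realized on one probability space, with a prescribed
coupling of the initial laws, so that they contract towards each other. -/
theorem exists_synchronous_coupling [IsProbabilityMeasure P] [IsProbabilityMeasure P']
    (hR : IsMemoryKernel R) (hab : DriftCondition a b ρ κ) (hρ : 0 < ρ) (hκ : 0 ≤ κ)
    (h : IsSolution a b M R σ P B X μ m) (h' : IsSolution a b M R σ P' B' X' μ' m')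
    {π : Measure (Vec d × Vec d)} (hπ : IsCoupling π (m 0).toMeasure (m' 0).toMeasure) :
    ∃ (Z : Type) (_ : MeasurableSpace Z) (Θ : Measure Z) (U U' : ℝ≥0 → Z → Vec d),
      IsProbabilityMeasure Θ ∧
      (Measurable fun q : ℝ≥0 × Z => U q.1 q.2) ∧ (Measurable fun q : ℝ≥0 × Z => U' q.1 q.2) ∧
      (∀ t, Θ.map (U t) = (m t).toMeasure) ∧ (∀ t, Θ.map (U' t) = (m' t).toMeasure) ∧
      Θ.map (fun z => (U 0 z, U' 0 z)) = π ∧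
      ∀ (s t : ℝ≥0) (D : ℝ), s ≤ t → (∀ r ∈ Icc s t, W2 (μ' r) (μ r) ^ 2 ≤ D) →
        ∀ᵐ z ∂Θ, Real.exp (2 * ρ * t) * (‖U t z - U' t z‖ ^ 2 - κ / ρ * D) ≤
          Real.exp (2 * ρ * s) * (‖U s z - U' s z‖ ^ 2 - κ / ρ * D) := by
  have hF := hab.measurable_drift fun A hA =>
    hR.measurable_average (fun A hA => h.measurable_law hA) h.memory hA
  have hF' := hab.measurable_drift fun A hA =>
    hR.measurable_average (fun A hA => h'.measurable_law hA) h'.memory hA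
  have hs : Measurable fun w : ℝ≥0 → Vec d => sample w :=
    measurable_pi_lambda _ fun _ => measurable_pi_apply _
  have hW : P.map (fun ω => sample fun t => B t ω) = P'.map (fun ω => sample fun t => B' t ω) := by
    have := congrArg (Measure.map fun w : ℝ≥0 → Vec d => sample w)
      (isBrownianVec_map_eq h.brownian h'.brownian)
    rw [Measure.map_map hs (measurable_pi_lambda _ h.brownian.measurable),
      Measure.map_map hs (measurable_pi_lambda _ h'.brownian.measurable)] at this
    exact this
  set W := P.map (fun ω => sample fun t => B t ω) with hWdef
  have : IsProbabilityMeasure W :=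
    Measure.isProbabilityMeasure_map (measurable_sample h.brownian.measurable).aemeasurable
  have := (m 0).isProbabilityMeasure
  have : IsProbabilityMeasure π := by
    refine ⟨?_⟩
    have := measure_univ (μ := (m 0).toMeasure)
    rwa [← hπ.1, Measure.map_apply measurable_fst MeasurableSet.univ, preimage_univ] at this
  have : IsProbabilityMeasure (solutionLaw P B X) :=
    Measure.isProbabilityMeasure_map h.measurable_triple.aemeasurable
  have : IsProbabilityMeasure (solutionLaw P' B' X') :=
    Measure.isProbabilityMeasure_map h'.measurable_triple.aemeasurable
  -- The base carries a pair of initial positions and a single noise; `f₁` and `f₂` each select one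
  -- position and keep that noise.
  let f₁ : (Vec d × Vec d) × GridPath d → Vec d × GridPath d := Prod.map Prod.fst id
  let f₂ : (Vec d × Vec d) × GridPath d → Vec d × GridPath d := Prod.map Prod.snd id
  have hf₁ : Measurable f₁ := measurable_fst.prodMap measurable_id
  have hf₂ : Measurable f₂ := measurable_snd.prodMap measurable_id
  have h₁ : (solutionLaw P B X).fst = (π.prod W).map f₁ := by
    rw [h.fst_solutionLaw, ← Measure.map_prod_map π W measurable_fst measurable_id, hπ.1,
      Measure.map_id]
  have h₂ : (solutionLaw P' B' X').fst = (π.prod W).map f₂ := by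
    rw [h'.fst_solutionLaw, ← Measure.map_prod_map π W measurable_snd measurable_id, hπ.2,
      Measure.map_id, hW]
  obtain ⟨Θ, hΘ, hΘν, hΘ₁, hΘ₂⟩ := exists_gluing (π.prod W) hf₁ hf₂ _ _ h₁ h₂
  let Z := ((Vec d × Vec d) × GridPath d) × (GridPath d × GridPath d)
  let G₁ : Z → (Vec d × GridPath d) × GridPath d := fun q => (f₁ q.1, q.2.1)
  let G₂ : Z → (Vec d × GridPath d) × GridPath d := fun q => (f₂ q.1, q.2.2)
  have hG₁ : Measurable G₁ :=
    (hf₁.comp measurable_fst).prodMk (measurable_fst.comp measurable_snd)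
  have hG₂ : Measurable G₂ :=
    (hf₂.comp measurable_fst).prodMk (measurable_snd.comp measurable_snd)
  change Θ.map G₁ = _ at hΘ₁
  change Θ.map G₂ = _ at hΘ₂
  have tr₁ : ∀ {p : (Vec d × GridPath d) × GridPath d → Prop},
      (∀ᵐ q ∂(solutionLaw P B X), p q) → ∀ᵐ q ∂Θ, p (G₁ q) := fun hp =>
    ae_of_ae_map hG₁.aemeasurable (hΘ₁ ▸ hp)
  have tr₂ : ∀ {p : (Vec d × GridPath d) × GridPath d → Prop},
      (∀ᵐ q ∂(solutionLaw P' B' X'), p q) → ∀ᵐ q ∂Θ, p (G₂ q) := fun hp =>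
    ae_of_ae_map hG₂.aemeasurable (hΘ₂ ▸ hp)
  let U : ℝ≥0 → Z → Vec d := fun t q => reconstruct (G₁ q).2 t
  let U' : ℝ≥0 → Z → Vec d := fun t q => reconstruct (G₂ q).2 t
  have hU : Measurable fun q : ℝ≥0 × Z => U q.1 q.2 :=
    measurable_reconstruct.comp
      ((measurable_snd.comp (hG₁.comp measurable_snd)).prodMk measurable_fst)
  have hU' : Measurable fun q : ℝ≥0 × Z => U' q.1 q.2 :=
    measurable_reconstruct.comp
      ((measurable_snd.comp (hG₂.comp measurable_snd)).prodMk measurable_fst)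
  have hUm : ∀ t, Θ.map (U t) = (m t).toMeasure := fun t => by
    rw [← h.map_solutionLaw t, ← hΘ₁, Measure.map_map (measurable_reconstruct_snd t) hG₁]
    rfl
  have hUm' : ∀ t, Θ.map (U' t) = (m' t).toMeasure := fun t => by
    rw [← h'.map_solutionLaw t, ← hΘ₂, Measure.map_map (measurable_reconstruct_snd t) hG₂]
    rfl
  have hU0 : Θ.map (fun z => (U 0 z, U' 0 z)) = π := by
    have e : (fun z => (U 0 z, U' 0 z)) =ᵐ[Θ] fun q => q.1.1 := by
      filter_upwards [tr₁ h.ae_solutionLaw_zero, tr₂ h'.ae_solutionLaw_zero] with q h1 h2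
      exact Prod.ext h1 h2
    have h3 := congrArg (Measure.map Prod.fst) hΘν
    rw [Measure.map_map measurable_fst measurable_fst, Measure.map_fst_prod, measure_univ,
      one_smul] at h3
    rw [Measure.map_congr e]
    exact h3
  refine ⟨Z, inferInstance, Θ, U, U', hΘ, hU, hU', hUm, hUm', hU0, fun s t D hst hD => ?_⟩
  filter_upwards [tr₁ (h.ae_solutionLaw hF), tr₂ (h'.ae_solutionLaw hF'),
    tr₁ (h.ae_solutionLaw_convergesAt s), tr₁ (h.ae_solutionLaw_convergesAt t),
    tr₂ (h'.ae_solutionLaw_convergesAt s), tr₂ (h'.ae_solutionLaw_convergesAt t)]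
    with q hd hd' hs ht hs' ht'
  exact hab.path_contraction hρ hκ hd hd' hst hD hs hs' ht ht'

end Solution

/-! ### Transport between averaged laws and second moments. -/

section Averages

variable {d : ℕ} {R : ℝ≥0 → Measure ℝ≥0} {Z : Type*} [MeasurableSpace Z] {Θ : Measure Z}
  [IsProbabilityMeasure Θ] {U U' : ℝ≥0 → Z → Vec d} {μ μ' m m' : ℝ≥0 → P2 d}

/-- Averaging the couplings of `m_u` and `m'_u` along `R(t, du)` couples `μ_t` and `μ'_t`. -/
lemma IsMemoryKernel.transportCost_average_le (hR : IsMemoryKernel R)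
    (hU : Measurable fun q : ℝ≥0 × Z => U q.1 q.2) (hU' : Measurable fun q : ℝ≥0 × Z => U' q.1 q.2)
    (hm : ∀ t, Θ.map (U t) = (m t).toMeasure) (hm' : ∀ t, Θ.map (U' t) = (m' t).toMeasure)
    (hμ : ∀ t A, MeasurableSet A →
      (μ t).toMeasure A = ∫⁻ s in Iic t, (m s).toMeasure A ∂(R t))
    (hμ' : ∀ t A, MeasurableSet A →
      (μ' t).toMeasure A = ∫⁻ s in Iic t, (m' s).toMeasure A ∂(R t)) (t : ℝ≥0) :
    transportCost (μ t) (μ' t) ≤ ∫⁻ u, ∫⁻ z, ‖U u z - U' u z‖ₑ ^ 2 ∂Θ ∂(R t) := by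
  have hprob := hR.prob
  have hUt : ∀ t, Measurable (U t) := fun t => hU.comp (measurable_const.prodMk measurable_id)
  have hUt' : ∀ t, Measurable (U' t) := fun t => hU'.comp (measurable_const.prodMk measurable_id)
  have hV : Measurable fun q : ℝ≥0 × Z => (U q.1 q.2, U' q.1 q.2) := hU.prodMk hU'
  have hmeas : ∀ {A : Set (Vec d × Vec d)}, MeasurableSet A →
      ((R t).prod Θ).map (fun q => (U q.1 q.2, U' q.1 q.2)) A =
        ∫⁻ u, Θ ((fun z => (U u z, U' u z)) ⁻¹' A) ∂(R t) := by
    intro A hA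
    rw [Measure.map_apply hV hA, Measure.prod_apply (hV hA)]
    rfl
  have hπ : IsCoupling (((R t).prod Θ).map fun q => (U q.1 q.2, U' q.1 q.2))
      (μ t).toMeasure (μ' t).toMeasure := by
    constructor
    · ext A hA
      rw [Measure.map_apply measurable_fst hA, hmeas (measurable_fst hA), hμ t A hA,
        Measure.restrict_eq_self_of_ae_mem (s := Iic t) (hR.ae_le t)]
      refine lintegral_congr fun u => ?_
      rw [← hm u, Measure.map_apply (hUt u) hA]
      rfl
    · ext A hA
      rw [Measure.map_apply measurable_snd hA, hmeas (measurable_snd hA), hμ' t A hA,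
        Measure.restrict_eq_self_of_ae_mem (s := Iic t) (hR.ae_le t)]
      refine lintegral_congr fun u => ?_
      rw [← hm' u, Measure.map_apply (hUt' u) hA]
      rfl
  refine (transportCost_le hπ).trans (le_of_eq ?_)
  rw [lintegral_map (by fun_prop) hV, lintegral_prod]
  exact ((hU.sub hU').enorm.pow_const 2).aemeasurable

end Averages

lemma integrable_norm_sq {d : ℕ} {Z : Type*} [MeasurableSpace Z] {Θ : Measure Z}
    {f : Z → Vec d} (hf : MemLp f 2 Θ) : Integrable (fun z => ‖f z‖ ^ 2) Θ :=
  (memLp_two_iff_integrable_sq_norm hf.1).1 hf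

lemma ofReal_integral_norm_sq {d : ℕ} {Z : Type*} [MeasurableSpace Z] {Θ : Measure Z}
    {f : Z → Vec d} (hf : MemLp f 2 Θ) :
    ENNReal.ofReal (∫ z, ‖f z‖ ^ 2 ∂Θ) = ∫⁻ z, ‖f z‖ₑ ^ 2 ∂Θ := by
  rw [ofReal_integral_eq_lintegral_ofReal (integrable_norm_sq hf)
    (Eventually.of_forall fun z => sq_nonneg _)]
  refine lintegral_congr fun z => ?_
  rw [ENNReal.ofReal_pow (norm_nonneg _), ofReal_norm]

lemma memLp_two_of_map_eq {d : ℕ} {Z : Type*} [MeasurableSpace Z] {Θ : Measure Z}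
    {f : Z → Vec d} (hf : Measurable f) {m : P2 d} (hm : Θ.map f = m.toMeasure) :
    MemLp f 2 Θ := by
  refine ⟨hf.aestronglyMeasurable, ?_⟩
  rw [eLpNorm_lt_top_iff_lintegral_rpow_enorm_lt_top (by norm_num) (by norm_num)]
  have h := m.2.2
  change secondMoment m.toMeasure < ∞ at h
  rw [secondMoment, ← hm, lintegral_map (by fun_prop) hf] at h
  simpa using h

lemma integral_norm_sub_sq_le {d : ℕ} {Z : Type*} [MeasurableSpace Z] {Θ : Measure Z}
    {f f' : Z → Vec d} (hf : MemLp f 2 Θ) (hf' : MemLp f' 2 Θ) :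
    ∫ z, ‖f z - f' z‖ ^ 2 ∂Θ ≤ 2 * ∫ z, ‖f z‖ ^ 2 ∂Θ + 2 * ∫ z, ‖f' z‖ ^ 2 ∂Θ := by
  rw [← integral_const_mul, ← integral_const_mul,
    ← integral_add ((integrable_norm_sq hf).const_mul 2) ((integrable_norm_sq hf').const_mul 2)]
  refine integral_mono (integrable_norm_sq (hf.sub hf'))
    (((integrable_norm_sq hf).const_mul 2).add ((integrable_norm_sq hf').const_mul 2)) fun z => ?_
  beta_reduce
  nlinarith [norm_sub_le (f z) (f' z), norm_nonneg (f z - f' z), sq_nonneg (‖f z‖ - ‖f' z‖)]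

/-! ### From solutions to profiles. -/

section Main

variable {d : ℕ} {a : Vec d → Vec d} {b : Vec d → P2 d → Vec d} {M : Matrix (Fin d) (Fin d) ℝ}
  {R : ℝ≥0 → Measure ℝ≥0} {σ : ℝ} {Ω : Type*} [MeasurableSpace Ω] {P : Measure Ω}
  {B X : ℝ≥0 → Ω → Vec d} {μ m : ℝ≥0 → P2 d} {Ω' : Type*} [MeasurableSpace Ω'] {P' : Measure Ω'}
  {B' X' : ℝ≥0 → Ω' → Vec d} {μ' m' : ℝ≥0 → P2 d} {ρ κ : ℝ}

/-- Starting from a coupling of the initial laws with cost less than `c`, the mean square distance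
of the synchronously coupled solutions is a contractive profile controlling the distances of the
laws and of their averages. -/
theorem exists_profile_of_solutions [IsProbabilityMeasure P] [IsProbabilityMeasure P']
    (hR : IsMemoryKernel R) (hab : DriftCondition a b ρ κ) (hκ : 0 ≤ κ) (hκρ : κ < ρ)
    (h : IsSolution a b M R σ P B X μ m) (h' : IsSolution a b M R σ P' B' X' μ' m')
    {c : ℝ} (hc0 : 0 ≤ c) (hc : transportCost (m 0) (m' 0) < ENNReal.ofReal c) :
    ∃ g, IsContractiveProfile R ρ κ c g ∧ (∀ t, W2 (m t) (m' t) ≤ √(g t)) ∧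
      ∀ t, W2 (μ t) (μ' t) ≤ √(∫⁻ u, ENNReal.ofReal (g u) ∂(R t)).toReal := by
  have hρ : 0 < ρ := hκ.trans_lt hκρ
  obtain ⟨π, hπ, hπc⟩ : ∃ π : Measure (Vec d × Vec d),
      IsCoupling π (m 0).toMeasure (m' 0).toMeasure ∧
      ∫⁻ p, ‖p.1 - p.2‖ₑ ^ 2 ∂π < ENNReal.ofReal c := by
    simpa [transportCost, iInf_lt_iff] using hc
  obtain ⟨Z, _, Θ, U, U', hΘ, hU, hU', hm, hm', h0, hcontr⟩ :=
    exists_synchronous_coupling hR hab hρ hκ h h' hπ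
  have hUt : ∀ t, Measurable (U t) := fun t => hU.comp (measurable_const.prodMk measurable_id)
  have hUt' : ∀ t, Measurable (U' t) := fun t => hU'.comp (measurable_const.prodMk measurable_id)
  have hL : ∀ t, MemLp (U t) 2 Θ := fun t => memLp_two_of_map_eq (hUt t) (hm t)
  have hL' : ∀ t, MemLp (U' t) 2 Θ := fun t => memLp_two_of_map_eq (hUt' t) (hm' t)
  let g : ℝ≥0 → ℝ := fun t => ∫ z, ‖U t z - U' t z‖ ^ 2 ∂Θ
  have hg0 : ∀ t, 0 ≤ g t := fun t => integral_nonneg fun z => sq_nonneg _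
  have hg : ∀ t, ENNReal.ofReal (g t) = ∫⁻ z, ‖U t z - U' t z‖ₑ ^ 2 ∂Θ := fun t =>
    ofReal_integral_norm_sq ((hL t).sub (hL' t))
  have hgi : ∀ t, Integrable (fun z => ‖U t z - U' t z‖ ^ 2) Θ := fun t =>
    integrable_norm_sq ((hL t).sub (hL' t))
  have hbound : ∀ {n : ℝ≥0 → P2 d} {V : ℝ≥0 → Z → Vec d}, (∀ t, Measurable (V t)) →
      (∀ t, MemLp (V t) 2 Θ) → (∀ t, Θ.map (V t) = (n t).toMeasure) → ∀ {T : ℝ≥0} {C : ℝ≥0},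
      (∀ s ≤ T, secondMoment (n s).toMeasure ≤ C) → ∀ s ≤ T, ∫ z, ‖V s z‖ ^ 2 ∂Θ ≤ C := by
    intro n V hV hVL hVn T C hC s hs
    rw [← ENNReal.ofReal_le_ofReal_iff C.coe_nonneg, ofReal_integral_norm_sq (hVL s)]
    have h1 := hC s hs
    rw [secondMoment, ← hVn s, lintegral_map (by fun_prop) (hV s)] at h1
    simpa using h1
  have hbdd : ∀ T, ∃ C, ∀ t ≤ T, g t ≤ C := by
    intro T
    obtain ⟨C, hC⟩ := h.moment T
    obtain ⟨C', hC'⟩ := h'.moment T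
    refine ⟨2 * C + 2 * C', fun t ht => (integral_norm_sub_sq_le (hL t) (hL' t)).trans ?_⟩
    have h1 := hbound hUt hL hm hC t ht
    have h2 := hbound hUt' hL' hm' hC' t ht
    linarith
  have hμ : ∀ t, transportCost (μ t) (μ' t) ≤ ∫⁻ u, ENNReal.ofReal (g u) ∂(R t) := by
    intro t
    simp_rw [hg]
    exact hR.transportCost_average_le hU hU' hm hm' h.memory h'.memory t
  -- The contraction condition has the measures in reversed order; swapping the roles of the coupled
  -- processes gives the bound without symmetry of `W2`.
  have hμ' : ∀ t, transportCost (μ' t) (μ t) ≤ ∫⁻ u, ENNReal.ofReal (g u) ∂(R t) := by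
    intro t
    simp_rw [hg, ← edist_eq_enorm_sub, edist_comm (U _ _), edist_eq_enorm_sub]
    exact hR.transportCost_average_le hU' hU hm' hm h'.memory h.memory t
  refine ⟨g, ⟨hg0, ?_, hbdd, fun s t D hst hD hr => ?_⟩, fun t => ?_, fun t => ?_⟩
  · rw [← ENNReal.ofReal_le_ofReal_iff hc0, hg]
    refine le_trans (le_of_eq ?_) hπc.le
    rw [← h0, lintegral_map (by fun_prop) ((hUt 0).prodMk (hUt' 0))]
  · have hW : ∀ r ∈ Icc s t, W2 (μ' r) (μ r) ^ 2 ≤ D := by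
      intro r hrst
      rw [W2, Real.sq_sqrt ENNReal.toReal_nonneg]
      exact ENNReal.toReal_le_of_le_ofReal hD ((hμ' r).trans (hr r hrst))
    have hint := fun r : ℝ≥0 => ((hgi r).sub (integrable_const (κ / ρ * D))).const_mul
      (Real.exp (2 * ρ * r))
    have hval : ∀ r : ℝ≥0, ∫ z, Real.exp (2 * ρ * r) * (‖U r z - U' r z‖ ^ 2 - κ / ρ * D) ∂Θ =
        Real.exp (2 * ρ * r) * (g r - κ / ρ * D) := by
      intro r
      rw [integral_const_mul, integral_sub (hgi r) (integrable_const _)]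
      simp [g]
    -- The null set of the pathwise bound may depend on `s`, `t` and `D`, since only expectations
    -- are compared.
    have := integral_mono_ae (hint t) (hint s) (hcontr s t D hst hW)
    simp only [Pi.sub_apply] at this
    rwa [hval, hval] at this
  · have hπt : IsCoupling (Θ.map fun z => (U t z, U' t z)) (m t).toMeasure (m' t).toMeasure := by
      constructor
      · rw [Measure.map_map measurable_fst ((hUt t).prodMk (hUt' t)), ← hm t]; rfl
      · rw [Measure.map_map measurable_snd ((hUt t).prodMk (hUt' t)), ← hm' t]; rfl
    have hle : transportCost (m t) (m' t) ≤ ENNReal.ofReal (g t) := by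
      refine (transportCost_le hπt).trans (le_of_eq ?_)
      rw [lintegral_map (by fun_prop) ((hUt t).prodMk (hUt' t)), hg]
    simpa [hg0 t] using W2_le_sqrt ENNReal.ofReal_ne_top hle
  · obtain ⟨C, hC⟩ := hbdd t
    exact W2_le_sqrt ((hR.lintegral_le hC).trans_lt ENNReal.ofReal_lt_top).ne (hμ t)

end Main

end MemorialMcKeanVlasov

end

open MemorialMcKeanVlasov
theorem proposition2p6
    (R : ℝ≥0 → Measure ℝ≥0) (hR : IsMemoryKernel R)
    (ρ κ : ℝ) (hκ : 0 ≤ κ) (hκρ : κ < ρ) :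
    ∃ Q : ℝ≥0 → ℝ, (∀ t, 0 < Q t) ∧ Tendsto Q atTop (𝓝 0) ∧
      ∀ (d : ℕ) (a : Vec d → Vec d) (b : Vec d → P2 d → Vec d)
        (M : Matrix (Fin d) (Fin d) ℝ) (σ : ℝ),
        DriftCondition a b ρ κ → 0 ≤ σ →
        ∀ (Ω : Type*) [MeasurableSpace Ω] (P : Measure Ω) [IsProbabilityMeasure P]
          (B X : ℝ≥0 → Ω → Vec d) (μ m : ℝ≥0 → P2 d)
          (Ω' : Type*) [MeasurableSpace Ω'] (P' : Measure Ω') [IsProbabilityMeasure P']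
          (B' X' : ℝ≥0 → Ω' → Vec d) (μ' m' : ℝ≥0 → P2 d),
          IsSolution a b M R σ P B X μ m →
          IsSolution a b M R σ P' B' X' μ' m' →
          ∀ t, W2 (m t) (m' t) + W2 (μ t) (μ' t) ≤ Q t * W2 (m 0) (m' 0) := by
  obtain ⟨Q, hQ, hQ0, hrate⟩ := exists_profile_rate hR hκ hκρ
  refine ⟨Q, hQ, hQ0, ?_⟩
  intro d a b M σ hab _ Ω _ P _ B X μ m Ω' _ P' _ B' X' μ' m' h h' t
  have hfin := (transportCost_lt_top (m 0) (m' 0)).ne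
  -- The slack `1 / (n + 1)` replaces an optimal plan by a nearly optimal one and keeps the initial
  -- bound positive even when the initial laws coincide. `Q` does not depend on `n`, so the slack
  -- can tend to `0`.
  have key : ∀ n : ℕ, W2 (m t) (m' t) + W2 (μ t) (μ' t) ≤
      Q t * √((transportCost (m 0) (m' 0)).toReal + 1 / ((n : ℝ) + 1)) := by
    intro n
    have hn : (0 : ℝ) < 1 / ((n : ℝ) + 1) := Nat.one_div_pos_of_nat
    have hc : 0 < (transportCost (m 0) (m' 0)).toReal + 1 / ((n : ℝ) + 1) :=
      add_pos_of_nonneg_of_pos ENNReal.toReal_nonneg hn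
    have hlt : transportCost (m 0) (m' 0) <
        ENNReal.ofReal ((transportCost (m 0) (m' 0)).toReal + 1 / ((n : ℝ) + 1)) := by
      rw [ENNReal.lt_ofReal_iff_toReal_lt hfin]
      linarith
    obtain ⟨g, hg, h1, h2⟩ := exists_profile_of_solutions hR hab hκ hκρ h h' hc.le hlt
    exact (add_le_add (h1 t) (h2 t)).trans (hrate _ g hc hg t)
  have hlim := ((tendsto_one_div_add_atTop_nhds_zero_nat (𝕜 := ℝ)).const_add
    (transportCost (m 0) (m' 0)).toReal).sqrt.const_mul (Q t)
  rw [add_zero] at hlim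
  exact ge_of_tendsto' hlim key
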